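/- For complex $x$ and $|p|<1$ let $(x;p)_\infty=\prod_{i\ge 0}(1-xp^i)$, and for $x\neq 0$ let $\theta(x;p)=(x;p)_\infty\,(p/x;p)_\infty$ be the modified theta function of nome $p$; for $p=0$ this reads $\theta(x;0)=1-x$, which is then also used at $x=0$. For a non-negative integer $k$ let $(x;q,p)_k=\prod_{j=0}^{k-1}\theta(xq^j;p)$, and write $(x_1,\dots,x_r;q,p)_k=(x_1;q,p)_k\cdots(x_r;q,p)_k$. Let $n$ be a non-negative integer, let $a,c,q$ be nonzero complex numbers, let $p$ be a complex number with $|p|<1$, and let $(A_j)_{j\ge 0}$ be an arbitrary sequence of complex numbers. Suppose that no denominator in the following identity vanishes. Then $$ \frac{(aq,\,aq/c;q,p)_n\,(c^2/a;q,p^2)_{2n}}{(c/a,\,c^2/a;q,p)_n\,(aq;q,p^2)_{2n}} \sum_{j=0}^{n}\frac{(cq^n,\,q^{-n};q,p)_j}{(cq^{-n}/a,\,c^2q^n/a;q,p)_j}\,A_j $$ $$ =\sum_{k=0}^{n}\frac{\theta(apq^{2k};p^2)\,(q^{-n},\,cq^n;q,p)_k\,(ap,\,a^2q/c^2;q,p^2)_k}{\theta(ap;p^2)\,(aq^{1+n},\,aq^{1-n}/c;q,p)_k\,(q,\,c^2p/a;q,p^2)_k}\,q^k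 \sum_{j=0}^{k}\frac{(apq^k,\,q^{-k};q,p^2)_j}{(c^2q^{-k}/a^2,\,c^2pq^k/a;q,p^2)_j}\,A_j . $$ -/

import Mathlib

/-- The infinite `q`-shifted factorial `(a; p)_∞ = ∏_{i ≥ 0} (1 - a p^i)`, for `|p| < 1`. -/
noncomputable def qFactorialInfty (a p : ℂ) : ℂ :=
  ∏' i : ℕ, (1 - a * p ^ i)

/-- The infinite product defining `(a; p)_∞` converges (absolutely) whenever `|p| < 1`. -/
theorem multipliable_qFactorialInfty (a p : ℂ) (hp : ‖p‖ < 1) :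
    Multipliable fun i : ℕ => 1 - a * p ^ i := by
  have h : Summable fun i : ℕ => ‖-(a * p ^ i)‖ := by
    simpa [norm_mul, norm_pow] using
      (summable_geometric_of_lt_one (norm_nonneg p) hp).mul_left ‖a‖
  simpa [sub_eq_add_neg] using multipliable_one_add_of_summable h

/-- The modified Jacobi theta function `θ(x; p) = (x; p)_∞ (p / x; p)_∞` of nome `p`, for `x ≠ 0`
and `|p| < 1`. For `p = 0` it is `1 - x`, and this is then also its value at `x = 0`. -/
noncomputable def modTheta (x p : ℂ) : ℂ :=
  qFactorialInfty x p * qFactorialInfty (p / x) p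

/-- The theta shifted factorial `(x; q, p)_k = ∏_{j=0}^{k-1} θ(x q^j; p)`, of base `q` and
nome `p`. -/
noncomputable def thetaFactorial (x q p : ℂ) (k : ℕ) : ℂ :=
  ∏ j ∈ Finset.range k, modTheta (x * q ^ j) p

/-!
Both sides are linear in the sequence `A`, so it suffices to compare the coefficients of `A j`. On the
right-hand side, put `k = j + m`. The theta shifted factorials split, and the coefficient becomes an
elementary factor (`coeffFactor`) times the sum over `m` that occurs for `j = 0`, with `a`, `c`, `n`
replaced by `a q ^ (2j)`, `c q ^ (2j)`, `n - j`
(`summand_eq_coeffFactor_mul_quadraticTerm`). So everything rests on the evaluation of this one sum,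
the quadratic summation `sum_quadraticTerm_eq_quadraticValue`.

By `θ(x; p) = θ(x; p ^ 2) θ(p x; p ^ 2)`, the quadratic summation has only factorials of nome
`P = p ^ 2`, and it is then the Frenkel-Turaev sum with base `a p` and parameters `q ^ (-n)`,
`p q ^ (-n)`, `c q ^ n`, `p c q ^ n`, `a ^ 2 q / c ^ 2`. The relation `P = p ^ 2` is not needed for
the summation, so the factor `p` in these parameters is replaced by a free variable `e`. For all but
countably many `e` the sum is a case of the elliptic binomial expansion `sum_expansionTerm` of
`(a x, a / x)_n` in the products `(b x, b / x)_k (c x, c / x)_(n - k)`, and the remaining values,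
including `e = 0` for `P = 0`, are reached by continuity (`sum_quadraticTerm`).

The expansion is proved by induction on `n`: the new factor `θ(a q ^ n x) θ(a q ^ n / x)` is a
combination of the factors that raise `k` and `n - k`, and the coefficients satisfy a Pascal
recurrence. Both facts are instances of the Weierstrass addition formula `modTheta_weierstrass`.
This in turn is a Plücker relation, because `θ(x y) θ(x / y) = x (f x * g y - g x * f y)` for suitable
functions `f`, `g` (`exists_modTheta_mul_eq_det`). To obtain `f` and `g`, write `θ` as a Laurent series
by the Jacobi triple product and split the double series for the product according to parity.
-/

/-! ### Basic properties of the modified theta function -/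

theorem qFactorialInfty_eq_mul_shift (x p : ℂ) (hp : ‖p‖ < 1) :
    qFactorialInfty x p = (1 - x) * qFactorialInfty (x * p) p := by
  unfold qFactorialInfty
  rw [tprod_eq_zero_mul']
  · simp only [pow_zero, mul_one, pow_succ']
    congr 1
    simp only [mul_assoc]
  · simpa only [pow_succ', mul_assoc] using multipliable_qFactorialInfty (x * p) p hp

theorem qFactorialInfty_zero_left (p : ℂ) : qFactorialInfty 0 p = 1 := by
  simp [qFactorialInfty]

theorem qFactorialInfty_zero_right (x : ℂ) : qFactorialInfty x 0 = 1 - x := by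
  rw [qFactorialInfty_eq_mul_shift x 0 (by simp), mul_zero, qFactorialInfty_zero_left, mul_one]

theorem modTheta_nome_zero (x : ℂ) : modTheta x 0 = 1 - x := by
  simp [modTheta, qFactorialInfty_zero_right]

theorem qFactorialInfty_eq_zero {x p : ℂ} (hp : ‖p‖ < 1) (h : qFactorialInfty x p = 0) :
    ∃ i : ℕ, x * p ^ i = 1 := by
  by_contra! hne
  refine tprod_one_add_ne_zero_of_summable (f := fun i : ℕ => -(x * p ^ i)) ?_ ?_ ?_
  · intro i h0
    exact hne i (by linear_combination -h0)
  · simpa [norm_mul, norm_pow] using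
      (summable_geometric_of_lt_one (norm_nonneg p) hp).mul_left ‖x‖
  · simpa [qFactorialInfty, sub_eq_add_neg] using h

theorem continuous_qFactorialInfty {p : ℂ} (hp : ‖p‖ < 1) :
    Continuous fun x => qFactorialInfty x p := by
  rw [continuous_iff_continuousAt]
  intro x
  have key := tendsto_tprod_one_add_of_dominated_convergence (𝓕 := nhds x)
    (f := fun y (i : ℕ) => -(y * p ^ i)) (g := fun i => -(x * p ^ i))
    (bound := fun i => (‖x‖ + 1) * ‖p‖ ^ i)
    ((summable_geometric_of_lt_one (norm_nonneg p) hp).mul_left _) ?_ ?_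
  · simpa [ContinuousAt, qFactorialInfty, sub_eq_add_neg] using key
  · intro i
    exact (Continuous.tendsto (by fun_prop) x)
  · have : ∀ᶠ y in nhds x, ‖y‖ < ‖x‖ + 1 :=
      continuous_norm.continuousAt.eventually_lt continuousAt_const (by simp)
    filter_upwards [this] with y hy i
    rw [norm_neg, norm_mul, norm_pow]
    gcongr

theorem continuousAt_modTheta {x p : ℂ} (hp : ‖p‖ < 1) (hx : x ≠ 0 ∨ p = 0) :
    ContinuousAt (fun y => modTheta y p) x := by
  rcases hx with hx | rfl
  · exact (continuous_qFactorialInfty hp).continuousAt.mul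
      ((continuous_qFactorialInfty hp).continuousAt.comp (f := fun y => p / y)
        (continuousAt_const.div continuousAt_id hx))
  · simp only [modTheta_nome_zero]
    fun_prop

/-- Inversion: `θ(1/x; p) = -θ(x; p)/x`. -/
theorem modTheta_inv {x p : ℂ} (hp : ‖p‖ < 1) (hx : x ≠ 0) :
    modTheta x⁻¹ p = -x⁻¹ * modTheta x p := by
  unfold modTheta
  rw [qFactorialInfty_eq_mul_shift x⁻¹ p hp, qFactorialInfty_eq_mul_shift x p hp, div_inv_eq_mul,
    show x⁻¹ * p = p / x by rw [div_eq_mul_inv, mul_comm], mul_comm p x]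
  field_simp
  ring

theorem modTheta_nome_div {x p : ℂ} (hp : p ≠ 0) : modTheta (p / x) p = modTheta x p := by
  rw [modTheta, modTheta, div_div_cancel₀ hp, mul_comm]

theorem qFactorialInfty_eq_sq (x p : ℂ) (hp : ‖p‖ < 1) :
    qFactorialInfty x p = qFactorialInfty x (p ^ 2) * qFactorialInfty (x * p) (p ^ 2) := by
  have hp2 : ‖p ^ 2‖ < 1 := by
    rw [norm_pow]; exact pow_lt_one₀ (norm_nonneg p) hp two_ne_zero
  unfold qFactorialInfty
  rw [← tprod_even_mul_odd]
  · simp only [pow_mul, pow_succ, mul_assoc]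
    simp only [mul_comm p, pow_zero, one_mul]
  · simpa only [pow_mul] using multipliable_qFactorialInfty x (p ^ 2) hp2
  · simpa only [pow_mul, pow_add, pow_one, mul_assoc, mul_comm p] using
      multipliable_qFactorialInfty (x * p) (p ^ 2) hp2

/-- Passing from nome `p` to nome `p ^ 2`. For `p = 0` the second factor is `θ(0; 0) = 1`. -/
theorem modTheta_eq_sq {x p : ℂ} (hp : ‖p‖ < 1) :
    modTheta x p = modTheta x (p ^ 2) * modTheta (p * x) (p ^ 2) := by
  rcases eq_or_ne p 0 with rfl | hp0
  · simp [modTheta_nome_zero]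
  · unfold modTheta
    rw [qFactorialInfty_eq_sq x p hp, qFactorialInfty_eq_sq (p / x) p hp, mul_comm p x]
    rw [show p ^ 2 / (x * p) = p / x by field_simp, show p / x * p = p ^ 2 / x by ring]
    ring

/-- For fixed `y ≠ 0`, the values of `t ≠ 0` with `θ(t y; p) = 0` form a countable set. -/
theorem countable_modTheta_mul_eq_zero {y p : ℂ} (hp : ‖p‖ < 1) (hy : y ≠ 0) :
    {t : ℂ | t ≠ 0 ∧ modTheta (t * y) p = 0}.Countable := by
  refine (((Set.countable_range fun i : ℕ => y⁻¹ * (p ^ i)⁻¹)).union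
    (Set.countable_range fun i : ℕ => y⁻¹ * p ^ (i + 1))).mono ?_
  rintro t ⟨ht, h⟩
  rcases mul_eq_zero.mp h with h | h
  · obtain ⟨i, hi⟩ := qFactorialInfty_eq_zero hp h
    left
    refine ⟨i, ?_⟩
    have hpi : p ^ i ≠ 0 := fun h0 => by simp [h0] at hi
    field_simp
    linear_combination -hi
  · obtain ⟨i, hi⟩ := qFactorialInfty_eq_zero hp h
    right
    refine ⟨i, ?_⟩
    field_simp at hi ⊢
    linear_combination hi

/-! ### The Jacobi triple product, up to a constant -/

/-- The Laurent series `∑ xⁿ r^(n² - n)`, summed over all integers `n`. -/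
noncomputable def thetaSeries (x r : ℂ) : ℂ :=
  ∑' n : ℤ, x ^ n * r ^ (n ^ 2 - n)

theorem summable_thetaSeries_real {x r : ℝ} (hx : 0 < x) (hr0 : 0 < r) (hr : r < 1) :
    Summable fun n : ℤ => x ^ n * r ^ (n ^ 2 - n) := by
  have aux : ∀ y : ℝ, 0 < y → Summable fun n : ℕ => (y * r ^ n) ^ n := by
    intro y hy
    have h0 : Filter.Tendsto (fun n : ℕ => y * r ^ n) Filter.atTop (nhds 0) := by
      simpa using (tendsto_pow_atTop_nhds_zero_of_lt_one hr0.le hr).const_mul y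
    refine Summable.of_norm_bounded_eventually_nat
      (summable_geometric_of_lt_one (r := (1 / 2 : ℝ)) (by norm_num) (by norm_num)) ?_
    filter_upwards [h0.eventually_lt_const (show (0 : ℝ) < 1 / 2 by norm_num)] with n hn
    rw [Real.norm_of_nonneg (by positivity)]
    gcongr
  refine Summable.of_nat_of_neg ?_ ?_
  · refine (aux (x / r) (by positivity)).congr fun n => ?_
    rw [mul_pow, div_pow, ← pow_mul, zpow_sub₀ hr0.ne', sq, zpow_mul]
    simp only [zpow_natCast, ← pow_mul]
    ring
  · refine (aux (r / x) (by positivity)).congr fun n => ?_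
    rw [mul_pow, div_pow, ← pow_mul, show (-(n : ℤ)) ^ 2 - -(n : ℤ) = ((n * n + n : ℕ) : ℤ) by
      push_cast; ring, zpow_neg]
    simp only [zpow_natCast, pow_add]
    field_simp

theorem summable_norm_thetaSeries {x r : ℂ} (hx : x ≠ 0) (hr0 : r ≠ 0) (hr : ‖r‖ < 1) :
    Summable fun n : ℤ => ‖x ^ n * r ^ (n ^ 2 - n)‖ := by
  simpa only [norm_mul, norm_zpow] using
    summable_thetaSeries_real (norm_pos_iff.mpr hx) (norm_pos_iff.mpr hr0) hr

/-- The finite product `(p; p)_k`. -/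
noncomputable def eulerProd (p : ℂ) (k : ℕ) : ℂ := ∏ i ∈ Finset.range k, (1 - p ^ (i + 1))

theorem eulerProd_ne_zero {p : ℂ} (hp : ‖p‖ < 1) (k : ℕ) : eulerProd p k ≠ 0 := by
  refine Finset.prod_ne_zero_iff.mpr fun i _ h => ?_
  have h1 : ‖p ^ (i + 1)‖ < 1 := by
    rw [norm_pow]; exact pow_lt_one₀ (norm_nonneg p) hp (Nat.succ_ne_zero i)
  rw [← sub_eq_zero.mp h] at h1
  simp at h1

theorem eulerProd_succ (p : ℂ) (k : ℕ) : eulerProd p (k + 1) = eulerProd p k * (1 - p ^ (k + 1)) :=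
  Finset.prod_range_succ _ _

theorem tendsto_eulerProd {p : ℂ} (hp : ‖p‖ < 1) :
    Filter.Tendsto (eulerProd p) Filter.atTop (nhds (qFactorialInfty p p)) := by
  refine (multipliable_qFactorialInfty p p hp).hasProd.tendsto_prod_nat.congr fun k => ?_
  simp only [eulerProd, pow_succ']

theorem qFactorialInfty_self_ne_zero {p : ℂ} (hp : ‖p‖ < 1) : qFactorialInfty p p ≠ 0 := by
  intro h
  obtain ⟨i, hi⟩ := qFactorialInfty_eq_zero hp h
  have h1 : ‖p ^ (i + 1)‖ < 1 := by
    rw [norm_pow]; exact pow_lt_one₀ (norm_nonneg p) hp (Nat.succ_ne_zero i)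
  rw [pow_succ', hi] at h1
  simp at h1

/-- The `p`-binomial coefficient. -/
noncomputable def gaussCoeff (p : ℂ) (n k : ℕ) : ℂ :=
  if k ≤ n then eulerProd p n / (eulerProd p k * eulerProd p (n - k)) else 0

theorem gaussCoeff_zero_right {p : ℂ} (hp : ‖p‖ < 1) (n : ℕ) : gaussCoeff p n 0 = 1 := by
  have h := eulerProd_ne_zero hp n
  simp [gaussCoeff, show eulerProd p 0 = 1 by simp [eulerProd], h]

theorem gaussCoeff_succ_succ {p : ℂ} (hp : ‖p‖ < 1) (n k : ℕ) (hk : k ≤ n) :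
    gaussCoeff p (n + 1) (k + 1) = gaussCoeff p n (k + 1) + p ^ (n - k) * gaussCoeff p n k := by
  obtain ⟨m, rfl⟩ := Nat.exists_eq_add_of_le hk
  have h0 := eulerProd_ne_zero hp
  cases m with
  | zero =>
    have h1 := h0 (k + 1)
    have h2 := h0 k
    simp [gaussCoeff, show eulerProd p 0 = 1 by simp [eulerProd], h1, h2]
  | succ m =>
    have h1 := h0 (m + 1)
    have h2 := h0 (k + 1)
    have h3 := h0 m
    have h4 := h0 k
    rw [eulerProd_succ] at h1 h2
    have h5 := right_ne_zero_of_mul h1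
    have h6 := right_ne_zero_of_mul h2
    simp only [gaussCoeff, show k + 1 ≤ k + (m + 1) + 1 by lia, show k + 1 ≤ k + (m + 1) by lia,
      show k ≤ k + (m + 1) by lia, if_true, show k + (m + 1) + 1 - (k + 1) = m + 1 by lia,
      show k + (m + 1) - (k + 1) = m by lia, show k + (m + 1) - k = m + 1 by lia,
      eulerProd_succ p (k + (m + 1)), eulerProd_succ p m, eulerProd_succ p k]
    field_simp
    ring

/-- The finite `p`-binomial theorem. -/
theorem prod_one_add_eq_sum_gaussCoeff {p : ℂ} (hp : ‖p‖ < 1) (y : ℂ) (n : ℕ) :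
    ∏ i ∈ Finset.range n, (1 + y * p ^ i) =
      ∑ k ∈ Finset.range (n + 1), gaussCoeff p n k * p ^ (k.choose 2) * y ^ k := by
  induction n with
  | zero => simp [gaussCoeff_zero_right hp]
  | succ n ih =>
    have hlast : gaussCoeff p n (n + 1) = 0 := by simp [gaussCoeff]
    have hext : ∑ k ∈ Finset.range (n + 1), gaussCoeff p n k * p ^ (k.choose 2) * y ^ k =
        1 + ∑ k ∈ Finset.range (n + 1),
          gaussCoeff p n (k + 1) * p ^ ((k + 1).choose 2) * y ^ (k + 1) := by
      have := Finset.sum_range_succ (fun k => gaussCoeff p n k * p ^ (k.choose 2) * y ^ k) (n + 1)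
      rw [hlast, zero_mul, zero_mul, add_zero] at this
      rw [← this, Finset.sum_range_succ']
      simp [gaussCoeff_zero_right hp, add_comm]
    rw [Finset.prod_range_succ, ih, mul_one_add, Finset.sum_mul, Finset.sum_range_succ' _ (n + 1)]
    nth_rw 1 [hext]
    rw [add_assoc, ← Finset.sum_add_distrib, add_comm]
    congr 1
    · refine Finset.sum_congr rfl fun k hk => ?_
      have hk : k ≤ n := Nat.lt_succ_iff.mp (Finset.mem_range.mp hk)
      rw [gaussCoeff_succ_succ hp n k hk, Nat.choose_succ_succ' k 1, Nat.choose_one_right, pow_add]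
      obtain ⟨m, rfl⟩ := Nat.exists_eq_add_of_le hk
      rw [Nat.add_sub_cancel_left]
      ring
    · simp [gaussCoeff_zero_right hp]

/-- The finite form of the Jacobi triple product, for the nome `w ^ 2`. -/
theorem prod_mul_prod_eq_sum_gaussCoeff {w x : ℂ} (hw0 : w ≠ 0) (hw : ‖w‖ < 1) (hx : x ≠ 0)
    (M : ℕ) :
    (∏ i ∈ Finset.range M, (1 - x * (w ^ 2) ^ i)) *
        ∏ i ∈ Finset.range M, (1 - w ^ 2 / x * (w ^ 2) ^ i) =
      ∑ k ∈ Finset.range (2 * M + 1), gaussCoeff (w ^ 2) (2 * M) k *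
        ((-x) ^ ((k : ℤ) - M) * w ^ (((k : ℤ) - M) ^ 2 - ((k : ℤ) - M))) := by
  have hp : ‖w ^ 2‖ < 1 := by
    rw [norm_pow]; exact pow_lt_one₀ (norm_nonneg w) hw two_ne_zero
  have hrefl : ∏ i ∈ Finset.range M, (1 + -x * (w ^ 2) ^ (-(M : ℤ)) * (w ^ 2) ^ i) =
      ((-x) ^ (M : ℤ) * w ^ (-(M : ℤ) ^ 2 - M)) *
        ∏ i ∈ Finset.range M, (1 - w ^ 2 / x * (w ^ 2) ^ i) := by
    rw [← Finset.prod_range_reflect]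
    have hmon : (-x) ^ (M : ℤ) * w ^ (-(M : ℤ) ^ 2 - M) =
        ∏ i ∈ Finset.range M, (-x * (w ^ 2) ^ (-((i : ℤ) + 1))) := by
      induction M with
      | zero => simp
      | succ M ih =>
        rw [Finset.prod_range_succ, ← ih]
        rw [← zpow_natCast w 2, ← zpow_mul, show (-((M + 1 : ℕ) : ℤ) ^ 2 - ((M + 1 : ℕ) : ℤ)) =
          (-(M : ℤ) ^ 2 - M) + ((2 : ℕ) : ℤ) * (-((M : ℤ) + 1)) by push_cast; ring, zpow_add₀ hw0]
        simp only [zpow_natCast, pow_succ]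
        ring
    rw [hmon, ← Finset.prod_mul_distrib]
    refine Finset.prod_congr rfl fun i hi => ?_
    have hi : i + 1 ≤ M := Finset.mem_range.mp hi
    obtain ⟨m, rfl⟩ := Nat.exists_eq_add_of_le hi
    rw [show i + 1 + m - 1 - i = m by lia, mul_assoc (-x), ← zpow_natCast (w ^ 2) m,
      ← zpow_add₀ (pow_ne_zero 2 hw0)]
    rw [show -((i + 1 + m : ℕ) : ℤ) + (m : ℤ) = -((i + 1 : ℕ) : ℤ) by push_cast; ring,
      show -((i : ℤ) + 1) = -((i + 1 : ℕ) : ℤ) by push_cast; ring, zpow_neg, zpow_natCast]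
    field_simp
    ring
  have hfull := prod_one_add_eq_sum_gaussCoeff hp (-x * (w ^ 2) ^ (-(M : ℤ))) (2 * M)
  rw [two_mul, Finset.prod_range_add, hrefl, ← two_mul] at hfull
  have hsecond : ∏ i ∈ Finset.range M, (1 + -x * (w ^ 2) ^ (-(M : ℤ)) * (w ^ 2) ^ (M + i)) =
      ∏ i ∈ Finset.range M, (1 - x * (w ^ 2) ^ i) := by
    refine Finset.prod_congr rfl fun i _ => ?_
    rw [pow_add, zpow_neg, zpow_natCast]
    field_simp
    ring
  rw [hsecond] at hfull
  have hE : (-x) ^ (M : ℤ) * w ^ (-(M : ℤ) ^ 2 - M) ≠ 0 :=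
    mul_ne_zero (zpow_ne_zero _ (neg_ne_zero.mpr hx)) (zpow_ne_zero _ hw0)
  refine mul_left_cancel₀ hE ?_
  rw [mul_comm (∏ i ∈ Finset.range M, (1 - x * (w ^ 2) ^ i)), ← mul_assoc, hfull, Finset.mul_sum]
  refine Finset.sum_congr rfl fun k _ => ?_
  have hchoose : ((k.choose 2 : ℕ) : ℤ) * 2 = (k : ℤ) ^ 2 - k := by
    cases k with
    | zero => simp
    | succ k =>
      rw [Nat.choose_two_right, Nat.add_sub_cancel]
      have := Nat.div_mul_cancel (Nat.even_mul_succ_self k).two_dvd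
      rw [mul_comm (k + 1) k]
      push_cast [← @Nat.cast_inj ℤ] at this ⊢
      rw [this]; ring
  have h1 : ((w ^ 2) ^ (k.choose 2) : ℂ) = w ^ ((k : ℤ) ^ 2 - k) := by
    rw [← hchoose, mul_comm, zpow_mul]; norm_cast
  have h2 : ((w ^ 2) ^ (-(M : ℤ))) ^ k = w ^ (-2 * (M : ℤ) * k) := by
    rw [zpow_mul, zpow_natCast, show -2 * (M : ℤ) = ((2 : ℕ) : ℤ) * (-(M : ℤ)) by push_cast; ring,
      zpow_mul, zpow_natCast w 2]
  rw [mul_pow, h1, h2]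
  have h3 : (-x) ^ (M : ℤ) * (-x) ^ ((k : ℤ) - M) = (-x) ^ k := by
    rw [← zpow_add₀ (neg_ne_zero.mpr hx), add_sub_cancel, zpow_natCast]
  have h4 : w ^ (-(M : ℤ) ^ 2 - M) * w ^ (((k : ℤ) - M) ^ 2 - ((k : ℤ) - M)) =
      w ^ ((k : ℤ) ^ 2 - k) * w ^ (-2 * (M : ℤ) * k) := by
    rw [← zpow_add₀ hw0, ← zpow_add₀ hw0]
    congr 1
    ring
  linear_combination (gaussCoeff (w ^ 2) (2 * M) k * w ^ ((k : ℤ) ^ 2 - k) *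
    w ^ (-2 * (M : ℤ) * k)) * (-h3) - (gaussCoeff (w ^ 2) (2 * M) k * (-x) ^ (M : ℤ) *
    (-x) ^ ((k : ℤ) - M)) * h4

theorem exists_bound_gaussCoeff {p : ℂ} (hp : ‖p‖ < 1) :
    ∃ C : ℝ, ∀ n k : ℕ, ‖gaussCoeff p n k‖ ≤ C := by
  obtain ⟨B, hB⟩ := (Metric.isBounded_range_of_tendsto _ (tendsto_eulerProd hp)).exists_norm_le
  obtain ⟨D, hD⟩ := (Metric.isBounded_range_of_tendsto _ ((tendsto_eulerProd hp).inv₀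
    (qFactorialInfty_self_ne_zero hp))).exists_norm_le
  have hB' : ∀ n, ‖eulerProd p n‖ ≤ B := fun n => hB _ ⟨n, rfl⟩
  have hD' : ∀ n, ‖(eulerProd p n)⁻¹‖ ≤ D := fun n => hD _ ⟨n, rfl⟩
  have hB0 : 0 ≤ B := (norm_nonneg _).trans (hB' 0)
  have hD0 : 0 ≤ D := (norm_nonneg _).trans (hD' 0)
  refine ⟨B * (D * D), fun n k => ?_⟩
  unfold gaussCoeff
  split_ifs
  · rw [div_eq_mul_inv, mul_inv, norm_mul, norm_mul]
    exact mul_le_mul (hB' n) (mul_le_mul (hD' _) (hD' _) (norm_nonneg _) hD0) (by positivity) hB0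
  · rw [norm_zero]; positivity

theorem tendsto_gaussCoeff {p : ℂ} (hp : ‖p‖ < 1) (n : ℤ) :
    Filter.Tendsto (fun M : ℕ => gaussCoeff p (2 * M) (n + M).toNat) Filter.atTop
      (nhds (qFactorialInfty p p)⁻¹) := by
  have hE := tendsto_eulerProd hp
  have h0 := qFactorialInfty_self_ne_zero hp
  have t1 : Filter.Tendsto (fun M : ℕ => 2 * M) Filter.atTop Filter.atTop :=
    Filter.tendsto_atTop_mono (f := fun M : ℕ => M) (fun M => by lia) Filter.tendsto_id
  have t2 : Filter.Tendsto (fun M : ℕ => (n + M).toNat) Filter.atTop Filter.atTop :=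
    Filter.tendsto_atTop_mono (f := fun M : ℕ => M - n.natAbs) (fun M => by lia)
      (Filter.tendsto_sub_atTop_nat _)
  have t3 : Filter.Tendsto (fun M : ℕ => 2 * M - (n + M).toNat) Filter.atTop Filter.atTop :=
    Filter.tendsto_atTop_mono' _ (f₁ := fun M : ℕ => M - n.natAbs)
      (Filter.Eventually.of_forall fun M => by lia) (Filter.tendsto_sub_atTop_nat _)
  have := (hE.comp t1).div ((hE.comp t2).mul (hE.comp t3)) (mul_ne_zero h0 h0)
  rw [div_mul_cancel_left₀ h0] at this
  refine this.congr' ?_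
  filter_upwards [Filter.eventually_ge_atTop n.natAbs] with M hM
  simp [gaussCoeff, show (n + M).toNat ≤ 2 * M by lia]

/-- The Jacobi triple product, without the value of the constant (the reciprocal of
`(w ^ 2; w ^ 2)_∞`), which is irrelevant for addition formulas. -/
theorem exists_modTheta_eq_thetaSeries {w : ℂ} (hw0 : w ≠ 0) (hw : ‖w‖ < 1) :
    ∃ κ : ℂ, ∀ x : ℂ, x ≠ 0 → modTheta x (w ^ 2) = κ * thetaSeries (-x) w := by
  have hp : ‖w ^ 2‖ < 1 := by
    rw [norm_pow]; exact pow_lt_one₀ (norm_nonneg w) hw two_ne_zero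
  refine ⟨(qFactorialInfty (w ^ 2) (w ^ 2))⁻¹, fun x hx => ?_⟩
  have hleft := ((multipliable_qFactorialInfty x (w ^ 2) hp).hasProd.tendsto_prod_nat).mul
    (multipliable_qFactorialInfty (w ^ 2 / x) (w ^ 2) hp).hasProd.tendsto_prod_nat
  obtain ⟨C, hC⟩ := exists_bound_gaussCoeff hp
  have hC0 : 0 ≤ C := (norm_nonneg _).trans (hC 0 0)
  have hright := tendsto_tsum_of_dominated_convergence (𝓕 := Filter.atTop)
    (f := fun (M : ℕ) (n : ℤ) => if n ∈ Finset.Icc (-(M : ℤ)) M then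
      gaussCoeff (w ^ 2) (2 * M) (n + M).toNat * ((-x) ^ n * w ^ (n ^ 2 - n)) else 0)
    (g := fun n => (qFactorialInfty (w ^ 2) (w ^ 2))⁻¹ * ((-x) ^ n * w ^ (n ^ 2 - n)))
    (bound := fun n => C * ‖(-x) ^ n * w ^ (n ^ 2 - n)‖)
    ((summable_norm_thetaSeries (neg_ne_zero.mpr hx) hw0 hw).mul_left C) ?_ ?_
  · rw [tsum_mul_left] at hright
    refine tendsto_nhds_unique hleft (hright.congr fun M => ?_)
    rw [prod_mul_prod_eq_sum_gaussCoeff hw0 hw hx M, tsum_eq_sum (s := Finset.Icc (-(M : ℤ)) M)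
      (fun n hn => if_neg hn)]
    refine Finset.sum_bij' (fun n _ => (n + M).toNat) (fun k _ => (k : ℤ) - M) ?_ ?_ ?_ ?_ ?_
    · intro n hn
      rw [Finset.mem_Icc] at hn
      rw [Finset.mem_range]
      lia
    · intro k hk
      rw [Finset.mem_range] at hk
      rw [Finset.mem_Icc]
      lia
    · intro n hn
      rw [Finset.mem_Icc] at hn
      lia
    · intro k hk
      lia
    · intro n hn
      rw [if_pos hn]
      rw [Finset.mem_Icc] at hn
      rw [show (((n + M).toNat : ℕ) : ℤ) - M = n by lia]
  · intro n
    refine ((tendsto_gaussCoeff hp n).mul_const _).congr' ?_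
    filter_upwards [Filter.eventually_ge_atTop n.natAbs] with M hM
    rw [if_pos (Finset.mem_Icc.mpr ⟨by lia, by lia⟩)]
  · refine Filter.Eventually.of_forall fun M n => ?_
    split_ifs
    · rw [norm_mul]
      gcongr
      exact hC _ _
    · rw [norm_zero]; positivity

/-! ### The Weierstrass addition formula -/

/-- The two parametrisations `(r, j) ↦ (r + j, r - j)` and `(r, j) ↦ (r + 1 + j, r - j)` of the
points of the plane lattice with even and with odd coordinate sum. -/
def evenOddLattice : (ℤ × ℤ) ⊕ (ℤ × ℤ) → ℤ × ℤ :=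
  Sum.elim (fun t => (t.1 + t.2, t.1 - t.2)) fun t => (t.1 + 1 + t.2, t.1 - t.2)

theorem bijective_evenOddLattice : Function.Bijective evenOddLattice := by
  constructor
  · rintro (⟨r, j⟩ | ⟨r, j⟩) (⟨r', j'⟩ | ⟨r', j'⟩) h <;>
      simp only [evenOddLattice, Sum.elim_inl, Sum.elim_inr, Prod.mk.injEq] at h <;>
      simp only [Sum.inl.injEq, Sum.inr.injEq, Prod.mk.injEq, reduceCtorEq] <;> lia
  · rintro ⟨m, n⟩
    rcases Int.even_or_odd' (m + n) with ⟨r, h | h⟩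
    · exact ⟨Sum.inl (r, m - r), by simp only [evenOddLattice, Sum.elim_inl, Prod.mk.injEq]; lia⟩
    · exact ⟨Sum.inr (r, m - r - 1), by
        simp only [evenOddLattice, Sum.elim_inr, Prod.mk.injEq]; lia⟩

/-- Separation of variables: splitting the double sum over the lattice by the parity of the
coordinate sum turns a product of two theta series into a sum of two products in which `A * B` and
`A / B` are separated. -/
theorem thetaSeries_mul_thetaSeries {A B w : ℂ} (hA : A ≠ 0) (hB : B ≠ 0) (hw0 : w ≠ 0)
    (hw : ‖w‖ < 1) :
    thetaSeries A w * thetaSeries B w =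
      thetaSeries (A * B) (w ^ 2) * thetaSeries (A / B * w ^ 2) (w ^ 2) +
        A * (thetaSeries (A * B * w ^ 2) (w ^ 2) * thetaSeries (A / B * w ^ 4) (w ^ 2)) := by
  have hp : ‖w ^ 2‖ < 1 := by
    rw [norm_pow]; exact pow_lt_one₀ (norm_nonneg w) hw two_ne_zero
  have hp0 : w ^ 2 ≠ 0 := pow_ne_zero 2 hw0
  have hw4 : w ^ 4 ≠ 0 := pow_ne_zero 4 hw0
  have hAB : A * B ≠ 0 := mul_ne_zero hA hB
  have hdAB : A / B ≠ 0 := div_ne_zero hA hB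
  have sA := summable_norm_thetaSeries hA hw0 hw
  have sB := summable_norm_thetaSeries hB hw0 hw
  have s := summable_mul_of_summable_norm sA sB
  obtain ⟨e, he⟩ : ∃ e : (ℤ × ℤ) ⊕ (ℤ × ℤ) ≃ ℤ × ℤ, ∀ t, e t = evenOddLattice t :=
    ⟨Equiv.ofBijective _ bijective_evenOddLattice, fun _ => rfl⟩
  have h1 := tsum_mul_tsum_of_summable_norm sA sB
  have h2 := tsum_mul_tsum_of_summable_norm (summable_norm_thetaSeries hAB hp0 hp)
    (summable_norm_thetaSeries (mul_ne_zero hdAB hp0) hp0 hp)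
  have h3 := tsum_mul_tsum_of_summable_norm
    (summable_norm_thetaSeries (mul_ne_zero hAB hp0) hp0 hp)
    (summable_norm_thetaSeries (mul_ne_zero hdAB hw4) hp0 hp)
  have hs := s.comp_injective e.injective
  have h4 := Summable.tsum_sum (hs.comp_injective Sum.inl_injective)
    (hs.comp_injective Sum.inr_injective)
  unfold thetaSeries
  rw [h1, h2, h3, ← e.tsum_eq, ← tsum_mul_left]
  refine h4.trans ?_
  have hpow : ∀ n : ℤ, (w ^ 2) ^ n = w ^ (2 * n) := fun n => by
    rw [zpow_mul]; norm_cast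
  have hpow4 : ∀ n : ℤ, (w ^ 4) ^ n = w ^ (4 * n) := fun n => by
    rw [zpow_mul]; norm_cast
  congr 1
  · refine tsum_congr fun t => ?_
    obtain ⟨r, j⟩ := t
    simp only [Function.comp_apply, he, evenOddLattice, Sum.elim_inl]
    rw [zpow_add₀ hA, zpow_sub₀ hB, mul_zpow A B, mul_zpow (A / B), div_zpow, hpow, hpow, hpow]
    have : w ^ ((r + j) ^ 2 - (r + j)) * w ^ ((r - j) ^ 2 - (r - j)) =
        w ^ (2 * (r ^ 2 - r)) * w ^ (2 * j) * w ^ (2 * (j ^ 2 - j)) := by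
      rw [← zpow_add₀ hw0, ← zpow_add₀ hw0, ← zpow_add₀ hw0]
      congr 1; ring
    linear_combination (A ^ r * A ^ j * (B ^ r / B ^ j)) * this
  · refine tsum_congr fun t => ?_
    obtain ⟨r, j⟩ := t
    simp only [Function.comp_apply, he, evenOddLattice, Sum.elim_inr]
    rw [zpow_add₀ hA, zpow_add₀ hA, zpow_one, zpow_sub₀ hB, mul_zpow (A * B), mul_zpow A B,
      mul_zpow (A / B), div_zpow, hpow, hpow, hpow, hpow4]
    have : w ^ ((r + 1 + j) ^ 2 - (r + 1 + j)) * w ^ ((r - j) ^ 2 - (r - j)) =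
        w ^ (2 * r) * w ^ (2 * (r ^ 2 - r)) * (w ^ (4 * j) * w ^ (2 * (j ^ 2 - j))) := by
      rw [← zpow_add₀ hw0, ← zpow_add₀ hw0, ← zpow_add₀ hw0, ← zpow_add₀ hw0]
      congr 1; ring
    linear_combination (A ^ r * A * A ^ j * (B ^ r / B ^ j)) * this

/-- Quasi-periodicity of the theta series. -/
theorem thetaSeries_eq_mul_shift {x r : ℂ} (hx : x ≠ 0) (hr : r ≠ 0) :
    thetaSeries x r = x * thetaSeries (x * r ^ 2) r := by
  unfold thetaSeries
  rw [← (Equiv.addRight (1 : ℤ)).tsum_eq, ← tsum_mul_left]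
  refine tsum_congr fun n => ?_
  rw [Equiv.coe_addRight, zpow_add₀ hx, zpow_one, mul_zpow,
    show (n + 1) ^ 2 - (n + 1) = ((2 : ℕ) : ℤ) * n + (n ^ 2 - n) by push_cast; ring, zpow_add₀ hr,
    zpow_mul, zpow_natCast]
  ring

/-- The rank-two structure behind the addition formula: up to the factor `x`, the product
`θ(x y) θ(x / y)` is a `2 × 2` determinant in functions of `x` and of `y` alone. -/
theorem exists_modTheta_mul_eq_det {p : ℂ} (hp : ‖p‖ < 1) :
    ∃ f g : ℂ → ℂ, ∀ x y : ℂ, x ≠ 0 → y ≠ 0 →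
      modTheta (x * y) p * modTheta (x / y) p = x * (f x * g y - g x * f y) := by
  rcases eq_or_ne p 0 with rfl | hp0
  · refine ⟨fun x => -1, fun x => x + 1 / x, fun x y hx hy => ?_⟩
    simp only [modTheta_nome_zero]
    field_simp
    ring
  · obtain ⟨w, rfl⟩ : ∃ w : ℂ, p = w ^ 2 :=
      (IsAlgClosed.exists_pow_nat_eq p two_pos).imp fun _ h => h.symm
    have hw0 : w ≠ 0 := fun h => hp0 (by simp [h])
    have hw : ‖w‖ < 1 := by
      rw [norm_pow] at hp
      exact (pow_lt_one_iff_of_nonneg (norm_nonneg w) two_ne_zero).mp hp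
    obtain ⟨κ, hκ⟩ := exists_modTheta_eq_thetaSeries hw0 hw
    refine ⟨fun x => κ * (x * thetaSeries (x ^ 2 * w ^ 4) (w ^ 2)),
      fun x => κ * thetaSeries (x ^ 2 * w ^ 2) (w ^ 2), fun x y hx hy => ?_⟩
    rw [hκ _ (mul_ne_zero hx hy), hκ _ (div_ne_zero hx hy), mul_mul_mul_comm,
      thetaSeries_mul_thetaSeries (neg_ne_zero.mpr (mul_ne_zero hx hy))
        (neg_ne_zero.mpr (div_ne_zero hx hy)) hw0 hw,
      show -(x * y) * -(x / y) = x ^ 2 by field_simp,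
      show -(x * y) / -(x / y) = y ^ 2 by field_simp,
      thetaSeries_eq_mul_shift (pow_ne_zero 2 hx) (pow_ne_zero 2 hw0),
      show (w ^ 2) ^ 2 = w ^ 4 by ring]
    ring

/-- The Weierstrass addition formula, which is the Plücker relation for the determinants of
`exists_modTheta_mul_eq_det`. -/
theorem modTheta_weierstrass {x y u v p : ℂ} (hp : ‖p‖ < 1) (hx : x ≠ 0) (hy : y ≠ 0)
    (hu : u ≠ 0) (hv : v ≠ 0) :
    y * (modTheta (x * y) p * modTheta (x / y) p * (modTheta (u * v) p * modTheta (u / v) p)) -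
      y * (modTheta (x * v) p * modTheta (x / v) p * (modTheta (u * y) p * modTheta (u / y) p)) =
    u * (modTheta (y * v) p * modTheta (y / v) p *
      (modTheta (x * u) p * modTheta (x / u) p)) := by
  obtain ⟨f, g, h⟩ := exists_modTheta_mul_eq_det hp
  rw [h x y hx hy, h u v hu hv, h x v hx hv, h u y hu hy, h y v hy hv, h x u hx hu]
  ring

/-! ### Theta shifted factorials -/

theorem thetaFactorial_zero (x q p : ℂ) : thetaFactorial x q p 0 = 1 := by
  simp [thetaFactorial]

theorem thetaFactorial_succ (x q p : ℂ) (k : ℕ) :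
    thetaFactorial x q p (k + 1) = thetaFactorial x q p k * modTheta (x * q ^ k) p :=
  Finset.prod_range_succ _ _

theorem thetaFactorial_add (x q p : ℂ) (k m : ℕ) :
    thetaFactorial x q p (k + m) = thetaFactorial x q p k * thetaFactorial (x * q ^ k) q p m := by
  unfold thetaFactorial
  rw [Finset.prod_range_add]
  simp only [pow_add, mul_assoc]

theorem thetaFactorial_succ_left (x q p : ℂ) (k : ℕ) :
    thetaFactorial x q p (k + 1) = modTheta x p * thetaFactorial (x * q) q p k := by
  rw [add_comm, thetaFactorial_add, thetaFactorial_succ, thetaFactorial_zero]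
  simp

theorem thetaFactorial_ne_zero_of_le {x q p : ℂ} {k n : ℕ} (h : k ≤ n)
    (hn : thetaFactorial x q p n ≠ 0) : thetaFactorial x q p k ≠ 0 := by
  obtain ⟨m, rfl⟩ := Nat.exists_eq_add_of_le h
  rw [thetaFactorial_add] at hn
  exact left_ne_zero_of_mul hn

/-! ### The elliptic binomial expansion -/

/-- The consequence of the Weierstrass addition formula that plays the role of the Pascal
recurrence. Its three products of four theta functions take the form `x y, x / y, u v, u / v`
required there only in terms of a square root of `U * Y`. -/
theorem modTheta_pascal {X Y U V W p : ℂ} (hp : ‖p‖ < 1) (hX : X ≠ 0) (hY : Y ≠ 0) (hU : U ≠ 0)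
    (hV : V ≠ 0) (h : V * W * Y = U) :
    Y * (modTheta X p * modTheta (U * X * Y) p * (modTheta V p * modTheta W p)) +
        modTheta Y p * modTheta U p * (modTheta (V * X * Y) p * modTheta (W * X * Y) p) =
      modTheta (X * Y) p * modTheta (U * X) p * (modTheta (V * Y) p * modTheta (W * Y) p) := by
  obtain ⟨s, hs⟩ := IsAlgClosed.exists_pow_nat_eq (U * Y) two_pos
  have hs0 : s ≠ 0 := by
    rintro rfl
    exact mul_ne_zero hU hY (by simpa using hs.symm)
  -- with `U = V W Y`, this choice turns the three products of the addition formula into the three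
  -- products of the claim
  have key := modTheta_weierstrass (x := X * s) (y := U / s) (u := s) (v := V * Y / s) hp
    (by positivity) (by positivity) hs0 (by positivity)
  have hUV : U / V = W * Y := by rw [← h]; field_simp
  rw [show X * s * (U / s) = U * X by field_simp,
    show X * s / (U / s) = X * Y by field_simp; rw [hs],
    show s * (V * Y / s) = V * Y by field_simp,
    show s / (V * Y / s) = W * Y by rw [← hUV]; field_simp; rw [hs]; field_simp,
    show X * s * (V * Y / s) = V * X * Y by field_simp,
    show X * s / (V * Y / s) = W * X * Y by
      rw [show W * X * Y = U / V * X by rw [hUV]; ring]; field_simp; rw [hs]; ring,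
    show s * (U / s) = U by field_simp,
    show s / (U / s) = Y by field_simp; rw [hs],
    show U / s * (V * Y / s) = V by field_simp; rw [hs],
    show U / s / (V * Y / s) = W by rw [← h]; field_simp,
    show X * s * s = U * X * Y by rw [mul_assoc, ← sq, hs]; ring,
    show X * s / s = X by field_simp] at key
  generalize modTheta (V * X * Y) p = t1 at *
  generalize modTheta (W * X * Y) p = t2 at *
  generalize modTheta (V * Y) p = t3 at *
  generalize modTheta (W * Y) p = t4 at *
  field_simp at key
  rw [hs] at key
  refine mul_left_cancel₀ hU ?_
  linear_combination -key

/-- The `(k, m)` summand of the expansion of `(a x, a / x; q, p)_{k + m}` in terms of the products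
`(b x, b / x; q, p)_k (c x, c / x; q, p)_m`. -/
noncomputable def expansionTerm (a b c x q p : ℂ) (k m : ℕ) : ℂ :=
  thetaFactorial q q p (k + m) /
      (q ^ (k * m) * (thetaFactorial q q p k * thetaFactorial q q p m)) *
    (thetaFactorial (a / c) q p k * thetaFactorial (a * c * q ^ m) q p k *
      (thetaFactorial (a / b) q p m * thetaFactorial (a * b * q ^ k) q p m)) /
    (thetaFactorial (b * c) q p (k + m) *
      (thetaFactorial (b / (c * q ^ m)) q p k * thetaFactorial (c / (b * q ^ k)) q p m)) *
    (thetaFactorial (b * x) q p k * thetaFactorial (b / x) q p k *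
      (thetaFactorial (c * x) q p m * thetaFactorial (c / x) q p m))

theorem expansionTerm_swap (a b c x q p : ℂ) (k m : ℕ) :
    expansionTerm a b c x q p k m = expansionTerm a c b x q p m k := by
  unfold expansionTerm
  rw [add_comm m k, mul_comm m k, mul_comm c b]
  ring

/-- The part of `expansionTerm k m`, multiplied by the new factor `θ(a q^(k+m) x^±)`, that
contributes to `expansionTerm (k + 1) m`. -/
noncomputable def expansionRaise (a b c x q p : ℂ) (k m : ℕ) : ℂ :=
  expansionTerm a b c x q p k m *
    (modTheta (a * c * q ^ (k + 2 * m)) p * modTheta (a / c * q ^ k) p *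
      (modTheta (b * x * q ^ k) p * modTheta (b / x * q ^ k) p)) /
    (modTheta (b * c * q ^ (k + m)) p * modTheta (b / (c * q ^ m) * q ^ k) p)

/-- The algebra behind the Pascal recurrence `expansionTerm_succ_succ`. The letters `u` stand for
values of `θ`, the letters `v` and `w` for shifted factorials, and `K`, `L`, `r` for `q ^ k`,
`q ^ m`, `q ^ (k * m)`. Since `u12` and `u13` may vanish, they are never divided by. -/
theorem expansion_algebra {b c q K L r u1 u2 u3 u4 u5 u6 u7 u8 u9 u10 u11 u12 u13 u14 u15 u16 u17
    u18 u19 u20 u21 v1 v2 v3 v4 v5 v6 v7 v8 v9 v10 v11 v12 v13 v14 w1 w2 d : ℂ}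
    (hb : b ≠ 0) (hc : c ≠ 0) (hq : q ≠ 0) (hK : K ≠ 0) (hL : L ≠ 0)
    (h6 : u6 ≠ 0) (h7 : u7 ≠ 0) (h8 : u8 ≠ 0) (h10 : u10 ≠ 0) (h11 : u11 ≠ 0)
    (hd : d = -(c / (b * K) * L)) (hw1 : w1 * u1 = u6 * v1) (hw2 : w2 * u2 = u7 * v2)
    (key : q * L * (u10 * u5 * (u13 * u7)) + u11 * u12 * (u4 * (-(c / b * (L * q)) * u6)) =
      u9 * u14 * (u15 * (d * u8))) :
    v7 * u9 / (r * K * L * q * (v8 * u10 * (v9 * u11))) *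
        (v5 * u16 * (v3 * u14) * (v6 * u17 * (v4 * u15))) /
        (v14 * u3 * (u6 * v1 * (u7 * v2))) *
        (v10 * u18 * (v11 * u19) * (v12 * u20 * (v13 * u21))) =
      v7 / (r * K * (v8 * (v9 * u11))) * (v5 * v3 * (v6 * u17 * (u13 * v4))) /
        (v14 * (w1 * (v2 * (d * u8)))) *
        (v10 * v11 * (v12 * u20 * (v13 * u21))) * (u5 * u16 * (u18 * u19)) / (u3 * u1) +
      v7 / (r * L * (v8 * u10 * v9)) * (v5 * u16 * (u12 * v3) * (v6 * v4)) /
        (v14 * (v1 * u8 * w2)) *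
        (v10 * u18 * (v11 * u19) * (v12 * v13)) * (u4 * u17 * (u20 * u21)) / (u3 * u2) := by
  have t1 : v7 / (r * K * (v8 * (v9 * u11))) * (v5 * v3 * (v6 * u17 * (u13 * v4))) /
        (v14 * (w1 * (v2 * (d * u8)))) *
        (v10 * v11 * (v12 * u20 * (v13 * u21))) * (u5 * u16 * (u18 * u19)) / (u3 * u1) =
      (v7 * v5 * u16 * v3 * v6 * u17 * v4 * v10 * u18 * v11 * u19 * v12 * u20 * v13 * u21 /
        (r * v8 * v9 * v14 * u3 * v2 * (w1 * u1))) * (u5 * u13 / (K * d * u11 * u8)) := by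
    ring
  have t2 : v7 / (r * L * (v8 * u10 * v9)) * (v5 * u16 * (u12 * v3) * (v6 * v4)) /
        (v14 * (v1 * u8 * w2)) *
        (v10 * u18 * (v11 * u19) * (v12 * v13)) * (u4 * u17 * (u20 * u21)) / (u3 * u2) =
      (v7 * v5 * u16 * v3 * v6 * u17 * v4 * v10 * u18 * v11 * u19 * v12 * u20 * v13 * u21 /
        (r * v8 * v9 * v14 * u3 * v1 * (w2 * u2))) * (u4 * u12 / (L * u10 * u8)) := by
    ring
  have small : u9 * u14 * u15 / (K * L * q * u10 * u11 * u6 * u7) =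
      u5 * u13 / (K * d * u11 * u8) / u6 + u4 * u12 / (L * u10 * u8) / u7 := by
    rw [hd] at key ⊢
    field_simp at key ⊢
    linear_combination key
  rw [t1, t2, hw1, hw2]
  linear_combination (v7 * v5 * u16 * v3 * v6 * u17 * v4 * v10 * u18 * v11 * u19 * v12 * u20 * v13 *
    u21 / (r * v8 * v9 * v14 * u3 * v1 * v2)) * small

section Expansion

variable {a b c x q p : ℂ}

/-- The three-term relation between the new factor, the factor raising `k` and the one raising
`m`. -/
theorem expansionTerm_mul_eq (hp : ‖p‖ < 1) (ha : a ≠ 0) (hb : b ≠ 0) (hc : c ≠ 0) (hx : x ≠ 0)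
    (hq : q ≠ 0) (k m : ℕ) (h1 : modTheta (b * c * q ^ (k + m)) p ≠ 0)
    (h2 : modTheta (b / (c * q ^ m) * q ^ k) p ≠ 0) :
    expansionTerm a b c x q p k m *
        (modTheta (a * x * q ^ (k + m)) p * modTheta (a / x * q ^ (k + m)) p) =
      expansionRaise a b c x q p k m + expansionRaise a c b x q p m k := by
  have hB : b * q ^ k ≠ 0 := by positivity
  have hC : c * q ^ m ≠ 0 := by positivity
  have key := modTheta_weierstrass (x := a * q ^ (k + m)) (y := x) (u := b * q ^ k)
    (v := c * q ^ m) hp (by positivity) hx hB hC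
  have i1 := modTheta_inv (x := c / x * q ^ m) hp (by positivity)
  have i2 := modTheta_inv (x := b / (c * q ^ m) * q ^ k) hp (by positivity)
  rw [show (c / x * q ^ m)⁻¹ = x / (c * q ^ m) by field_simp] at i1
  rw [show (b / (c * q ^ m) * q ^ k)⁻¹ = c / (b * q ^ k) * q ^ m by field_simp] at i2
  unfold expansionRaise
  rw [← expansionTerm_swap a b c x q p k m, i2]
  rw [i1, show a * q ^ (k + m) * x = a * x * q ^ (k + m) by ring,
    show a * q ^ (k + m) / x = a / x * q ^ (k + m) by ring,
    show b * q ^ k * (c * q ^ m) = b * c * q ^ (k + m) by ring,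
    show b * q ^ k / (c * q ^ m) = b / (c * q ^ m) * q ^ k by ring,
    show a * q ^ (k + m) * (c * q ^ m) = a * c * q ^ (k + 2 * m) by ring,
    show a * q ^ (k + m) / (c * q ^ m) = a / c * q ^ k by rw [pow_add]; field_simp,
    show b * q ^ k * x = b * x * q ^ k by ring, show b * q ^ k / x = b / x * q ^ k by ring,
    show x * (c * q ^ m) = c * x * q ^ m by ring,
    show a * q ^ (k + m) * (b * q ^ k) = a * b * q ^ (m + 2 * k) by ring,
    show a * q ^ (k + m) / (b * q ^ k) = a / b * q ^ m by rw [pow_add]; field_simp] at key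
  rw [show c * b * q ^ (m + k) = b * c * q ^ (k + m) by ring]
  generalize modTheta (b * c * q ^ (k + m)) p = t1 at *
  generalize modTheta (b / (c * q ^ m) * q ^ k) p = t2 at *
  generalize modTheta (a * x * q ^ (k + m)) p = t3 at *
  generalize modTheta (a / x * q ^ (k + m)) p = t4 at *
  generalize modTheta (a * c * q ^ (k + 2 * m)) p = t5 at *
  generalize modTheta (a / c * q ^ k) p = t6 at *
  generalize modTheta (b * x * q ^ k) p = t7 at *
  generalize modTheta (b / x * q ^ k) p = t8 at *
  generalize modTheta (c * x * q ^ m) p = t9 at *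
  generalize modTheta (c / x * q ^ m) p = t10 at *
  generalize modTheta (a * b * q ^ (m + 2 * k)) p = t11 at *
  generalize modTheta (a / b * q ^ m) p = t12 at *
  generalize expansionTerm a b c x q p k m = T at *
  field_simp at key ⊢
  linear_combination T * key

/-- The Pascal recurrence at the edge, where only one of the two contributions is present. -/
theorem expansionTerm_succ_zero (k : ℕ) (hq0 : thetaFactorial q q p (k + 1) ≠ 0) :
    expansionTerm a b c x q p (k + 1) 0 = expansionRaise a b c x q p k 0 := by
  have h1 := hq0
  rw [thetaFactorial_succ] at h1
  have h2 := left_ne_zero_of_mul h1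
  unfold expansionRaise expansionTerm
  simp only [thetaFactorial_zero, add_zero, mul_zero, pow_zero, mul_one, div_self h2,
    one_mul, thetaFactorial_succ _ q p k]
  rw [div_self h1]
  ring

/-- The Pascal recurrence for the summands of the expansion. -/
theorem expansionTerm_succ_succ (hp : ‖p‖ < 1) (ha : a ≠ 0) (hb : b ≠ 0) (hc : c ≠ 0)
    (hq : q ≠ 0) (k m : ℕ) (hq0 : ∀ i, i ≤ k + m + 2 → thetaFactorial q q p i ≠ 0)
    (h2 : ∀ i j : ℕ, modTheta (b / (c * q ^ i) * q ^ j) p ≠ 0) :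
    expansionTerm a b c x q p (k + 1) (m + 1) =
      expansionRaise a b c x q p k (m + 1) + expansionRaise a c b x q p m (k + 1) := by
  have h3 : ∀ i j : ℕ, modTheta (c / (b * q ^ i) * q ^ j) p =
      -(c / (b * q ^ i) * q ^ j) * modTheta (b / (c * q ^ j) * q ^ i) p := by
    intro i j
    rw [show c / (b * q ^ i) * q ^ j = (b / (c * q ^ j) * q ^ i)⁻¹ by field_simp,
      modTheta_inv hp (by positivity)]
  have h4 : ∀ i j : ℕ, modTheta (c / (b * q ^ i) * q ^ j) p ≠ 0 := by
    intro i j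
    rw [h3]
    exact mul_ne_zero (neg_ne_zero.mpr (by positivity)) (h2 j i)
  have hQk := hq0 (k + 1) (by lia)
  have hQm := hq0 (m + 1) (by lia)
  rw [thetaFactorial_succ] at hQk hQm
  have f1 := h2 (m + 1) 0
  have f1' := h4 (k + 1) 0
  rw [pow_zero, mul_one] at f1 f1'
  -- the factorials whose base is shifted, expressed through the factorials common to all three
  -- terms of the recurrence
  have e1 : thetaFactorial (b / (c * q ^ (m + 1))) q p (k + 1) =
      modTheta (b / (c * q ^ (m + 1))) p * thetaFactorial (b / (c * q ^ m)) q p k := by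
    rw [thetaFactorial_succ_left]
    congr 2
    rw [pow_succ]
    field_simp
  have e2 := thetaFactorial_succ (b / (c * q ^ (m + 1))) q p k
  rw [e1] at e2
  have e3 : thetaFactorial (c / (b * q ^ (k + 1))) q p (m + 1) =
      modTheta (c / (b * q ^ (k + 1))) p * thetaFactorial (c / (b * q ^ k)) q p m := by
    rw [thetaFactorial_succ_left]
    congr 2
    rw [pow_succ]
    field_simp
  have e4 := thetaFactorial_succ (c / (b * q ^ (k + 1))) q p m
  rw [e3] at e4
  have e5 : thetaFactorial (a * b * q ^ k) q p (m + 1) =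
      modTheta (a * b * q ^ k) p * thetaFactorial (a * b * q ^ (k + 1)) q p m := by
    rw [thetaFactorial_succ_left, mul_assoc _ (q ^ k), ← pow_succ]
  have e6 : thetaFactorial (a * c * q ^ m) q p (k + 1) =
      modTheta (a * c * q ^ m) p * thetaFactorial (a * c * q ^ (m + 1)) q p k := by
    rw [thetaFactorial_succ_left, mul_assoc _ (q ^ m), ← pow_succ]
  have key := modTheta_pascal (X := q * q ^ k) (Y := q * q ^ m) (U := a * c * q ^ m)
    (V := a * b * q ^ k) (W := c / (b * q ^ (k + 1))) hp (by positivity) (by positivity)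
    (by positivity) (by positivity) (by rw [pow_succ]; field_simp)
  have i1 := h3 k m
  have i2 := h3 0 (m + 1)
  have n1 := h2 m k
  rw [show a * c * q ^ m * (q * q ^ k) * (q * q ^ m) = a * c * q ^ (k + 2 * (m + 1)) by ring,
    show a * b * q ^ k * (q * q ^ k) * (q * q ^ m) = a * b * q ^ (m + 2 * (k + 1)) by ring,
    show c / (b * q ^ (k + 1)) * (q * q ^ k) * (q * q ^ m) = c / (b * q ^ 0) * q ^ (m + 1) by
      rw [pow_succ, pow_succ]; field_simp,
    show q * q ^ k * (q * q ^ m) = q * q ^ (k + m + 1) by ring,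
    show a * c * q ^ m * (q * q ^ k) = a * c * q ^ (m + 1) * q ^ k by ring,
    show a * b * q ^ k * (q * q ^ m) = a * b * q ^ (k + 1) * q ^ m by ring,
    show c / (b * q ^ (k + 1)) * (q * q ^ m) = c / (b * q ^ k) * q ^ m by
      rw [pow_succ]; field_simp, i2] at key
  rw [i1] at key
  have hR : expansionRaise a c b x q p m (k + 1) = expansionTerm a b c x q p (k + 1) m *
    (modTheta (a * b * q ^ (m + 2 * (k + 1))) p * modTheta (a / b * q ^ m) p *
      (modTheta (c * x * q ^ m) p * modTheta (c / x * q ^ m) p)) /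
    (modTheta (b * c * q ^ (k + m + 1)) p * modTheta (c / (b * q ^ (k + 1)) * q ^ m) p) := by
    rw [expansionRaise, ← expansionTerm_swap, mul_comm c b, show m + (k + 1) = k + m + 1 by ring]
  rw [hR]
  unfold expansionRaise expansionTerm
  rw [show k + 1 + (m + 1) = k + m + 1 + 1 by ring, show k + (m + 1) = k + m + 1 by ring,
    show k + 1 + m = k + m + 1 by ring]
  rw [e1, e3, e5, e6, thetaFactorial_succ (b / (c * q ^ m)),
    thetaFactorial_succ (c / (b * q ^ k)), i1]
  simp only [thetaFactorial_succ _ q p k, thetaFactorial_succ _ q p m,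
    thetaFactorial_succ _ q p (k + m + 1)]
  rw [pow_zero, mul_one, mul_one, pow_succ q m] at key
  rw [show (k + 1) * (m + 1) = k * m + k + m + 1 by ring, show k * (m + 1) = k * m + k by ring,
    show (k + 1) * m = k * m + m by ring]
  simp only [pow_add q (k * m + k + m), pow_add q (k * m + k), pow_add q (k * m), pow_one]
  exact expansion_algebra hb hc hq (pow_ne_zero k hq) (pow_ne_zero m hq) f1 f1' n1
    (right_ne_zero_of_mul hQk) (right_ne_zero_of_mul hQm) rfl e2.symm e4.symm key

/-- The elliptic binomial expansion: a form of the Frenkel-Turaev summation, stated for generic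
`b * c` and `b / c`. -/
theorem sum_expansionTerm (hp : ‖p‖ < 1) (ha : a ≠ 0) (hb : b ≠ 0) (hc : c ≠ 0) (hx : x ≠ 0)
    (hq : q ≠ 0) (n : ℕ) (hq0 : thetaFactorial q q p n ≠ 0)
    (h1 : ∀ i : ℕ, modTheta (b * c * q ^ i) p ≠ 0)
    (h2 : ∀ i j : ℕ, modTheta (b / (c * q ^ i) * q ^ j) p ≠ 0) :
    ∑ t ∈ Finset.HasAntidiagonal.antidiagonal n, expansionTerm a b c x q p t.1 t.2 =
      thetaFactorial (a * x) q p n * thetaFactorial (a / x) q p n := by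
  induction n with
  | zero => simp [expansionTerm, thetaFactorial_zero]
  | succ n ih =>
    -- the contributions to the `(k, m)` summand that raise `k` and that raise `m`
    let G : ℕ → ℕ → ℂ := fun k m => k.casesOn 0 fun k => expansionRaise a b c x q p k m
    let R : ℕ → ℕ → ℂ := fun k m => m.casesOn 0 fun m => expansionRaise a c b x q p m k
    have hsplit : ∀ t ∈ Finset.HasAntidiagonal.antidiagonal (n + 1),
        expansionTerm a b c x q p t.1 t.2 = G t.1 t.2 + R t.1 t.2 := by
      rintro ⟨k, m⟩ ht
      rw [Finset.HasAntidiagonal.mem_antidiagonal] at ht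
      rcases k with _ | k <;> rcases m with _ | m
      · simp at ht
      · obtain rfl : m = n := by simp only at ht; lia
        rw [expansionTerm_swap, expansionTerm_succ_zero _ hq0]
        exact (zero_add _).symm
      · obtain rfl : k = n := by simp only at ht; lia
        rw [expansionTerm_succ_zero _ hq0]
        exact (add_zero _).symm
      · exact expansionTerm_succ_succ hp ha hb hc hq k m
          (fun i hi => thetaFactorial_ne_zero_of_le (by simp only at ht; lia) hq0) h2
    rw [Finset.sum_congr rfl hsplit, Finset.sum_add_distrib, Finset.Nat.sum_antidiagonal_succ,
      Finset.Nat.sum_antidiagonal_succ', thetaFactorial_succ, thetaFactorial_succ,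
      mul_mul_mul_comm, ← ih (thetaFactorial_ne_zero_of_le n.le_succ hq0), Finset.sum_mul]
    change 0 + _ + (0 + _) = _
    rw [zero_add, zero_add, ← Finset.sum_add_distrib]
    refine Finset.sum_congr rfl fun t ht => ?_
    rw [Finset.HasAntidiagonal.mem_antidiagonal] at ht
    rw [← ht]
    exact (expansionTerm_mul_eq hp ha hb hc hx hq t.1 t.2 (h1 _) (h2 _ _)).symm

end Expansion

/-! ### The quadratic summation -/

/-- Reversal of a theta shifted factorial: `z` is `q ^ (1 - k) / y`. -/
theorem thetaFactorial_reflect {y z q p : ℂ} (hp : ‖p‖ < 1) (hq : q ≠ 0) (k : ℕ)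
    (h : y * z * q ^ k = q) :
    thetaFactorial y q p k = (-y) ^ k * q ^ k.choose 2 * thetaFactorial z q p k := by
  induction k generalizing z with
  | zero => simp [thetaFactorial_zero]
  | succ k ih =>
    have h' : z * (y * q ^ k) = 1 := by
      refine mul_right_cancel₀ hq ?_
      rw [pow_succ] at h
      linear_combination h
    have hz : z ≠ 0 := left_ne_zero_of_mul_eq_one h'
    have hinv : y * q ^ k = z⁻¹ := eq_inv_of_mul_eq_one_right h'
    rw [thetaFactorial_succ, thetaFactorial_succ_left z,
      ih (z := z * q) (by rw [pow_succ] at h; linear_combination h), hinv, modTheta_inv hp hz,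
      ← hinv, Nat.choose_succ_succ' k 1, Nat.choose_one_right, pow_add, pow_succ]
    ring

/-- Splitting off the last `k` factors of a theta shifted factorial, in reversed form: `z` is
`q ^ (1 - k - m) / y`. -/
theorem thetaFactorial_add_reflect {y z q p : ℂ} (hp : ‖p‖ < 1) (hq : q ≠ 0) (k m : ℕ)
    (h : y * z * q ^ (k + m) = q) :
    thetaFactorial y q p (k + m) =
      thetaFactorial y q p m * ((-(y * q ^ m)) ^ k * q ^ k.choose 2 * thetaFactorial z q p k) := by
  rw [add_comm, thetaFactorial_add,
    thetaFactorial_reflect (y := y * q ^ m) (z := z) hp hq k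
    (by rw [pow_add] at h; linear_combination h)]

/-- Two ways to split `(x)_{2 k + m + 1}`. The left-hand side has the
well-poised form, the right-hand side the one that occurs in the expansion. -/
theorem modTheta_mul_thetaFactorial_split (x q p : ℂ) (k m : ℕ) :
    modTheta x p * (thetaFactorial (x * q) q p (k + m) *
        thetaFactorial (x * q ^ (1 + (k + m))) q p k) =
      thetaFactorial x q p k * modTheta (x * q ^ (2 * k)) p *
        (thetaFactorial (x * q ^ k) q p k * thetaFactorial (x * q ^ (2 * k + 1)) q p m) := by
  rw [show x * q ^ (1 + (k + m)) = x * q * q ^ (k + m) by ring, ← thetaFactorial_add,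
    ← thetaFactorial_succ_left, show k + m + k + 1 = k + k + 1 + m by ring,
    thetaFactorial_add, thetaFactorial_succ, thetaFactorial_add x q p k k, ← two_mul]
  ring

/-- The summand of the quadratic summation, of nome `P`, with the summation variable `k`. In the
application `P = e ^ 2`; here `e` is kept free. -/
noncomputable def quadraticTerm (a c e q P : ℂ) (n k : ℕ) : ℂ :=
  modTheta (a * e * q ^ (2 * k)) P * thetaFactorial (a * e) q P k *
      (thetaFactorial (q ^ (-(n : ℤ))) q P k * thetaFactorial (e * q ^ (-(n : ℤ))) q P k *
        (thetaFactorial (c * q ^ n) q P k * thetaFactorial (e * (c * q ^ n)) q P k)) *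
      thetaFactorial (a ^ 2 * q / c ^ 2) q P k /
    (thetaFactorial (a * q ^ (1 + n)) q P k * thetaFactorial (e * (a * q ^ (1 + n))) q P k *
      (thetaFactorial (a * q ^ (1 - (n : ℤ)) / c) q P k *
        thetaFactorial (e * (a * q ^ (1 - (n : ℤ)) / c)) q P k) *
      (thetaFactorial q q P k * thetaFactorial (e * (c ^ 2 / a)) q P k)) * q ^ k

/-- The monomials produced by the reversals in `expansionTerm_eq_quadraticTerm` combine to `q ^ k`
times a factor depending on `k + m` only. -/
theorem reflect_monomial_identity {a c e q : ℂ} (ha : a ≠ 0) (hc : c ≠ 0) (he : e ≠ 0) (hq : q ≠ 0)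
    (k m : ℕ) :
    (-(q * q ^ m)) ^ k * q ^ k.choose 2 * ((-(c ^ 2 / (a ^ 2 * q ^ k))) ^ k * q ^ k.choose 2) *
        ((-(c / (a * e))) ^ (k + m) * q ^ (k + m).choose 2) =
      q ^ k * (c * q ^ (k + m)) ^ (k + m) * q ^ (k * m) *
        ((-(c / (a * e) * q ^ m)) ^ k * q ^ k.choose 2) *
        ((-(1 / (a * q ^ (2 * (k + m))) * q ^ m)) ^ k * q ^ k.choose 2) *
        ((-(c / a * q ^ m)) ^ k * q ^ k.choose 2) *
        ((-(1 / (a * e * q ^ (k + m + k)))) ^ m * q ^ m.choose 2) := by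
  have h : (k + m).choose 2 = k.choose 2 + m.choose 2 + k * m := by
    induction m with
    | zero => simp
    | succ m ih =>
      rw [← add_assoc, Nat.choose_succ_succ' (k + m) 1, Nat.choose_succ_succ' m 1, ih]
      simp only [Nat.choose_one_right]
      ring
  rw [h]
  simp only [neg_pow (_ * _), neg_pow (_ / _), mul_pow, div_pow, pow_add, ← pow_mul,
    one_pow]
  field_simp
  ring

/-- The algebra behind `expansionTerm_eq_quadraticTerm`: the letters `M` stand for monomials, the
other ones for values of `θ` and shifted factorials. -/
theorem quadratic_algebra {Qm Qk M1 M3 M4 M4' M8 M10 M11 Nq X2 D X9 X9b a4m a5 a7 a8 a10m a11m A6 H h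
    g F4 f4 f5 f10 f11 th th2 r K qk : ℂ} (hQm : Qm ≠ 0) (hM4 : M4 ≠ 0) (hM8 : M8 ≠ 0)
    (ha7 : a7 ≠ 0) (ha8 : a8 ≠ 0) (hA6 : A6 ≠ 0) (hh : h ≠ 0) (hf4 : f4 ≠ 0) (hf5 : f5 ≠ 0)
    (hf10 : f10 ≠ 0) (hf11 : f11 ≠ 0) (hr : r ≠ 0) (h4 : M4' * F4 = a4m * (M4 * f4))
    (h7 : th * (H * h) = g * th2 * (a7 * a8))
    (hM : M1 * M3 * M4' = qk * K * r * M4 * M10 * M11 * M8) :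
    Qm * (M1 * Nq) / (r * (Qk * Qm)) * (X2 * (M3 * D) * (a4m * a5)) / (A6 * (a7 * (M8 * a8))) *
          (X9 * X9b * (a10m * a11m)) * (A6 * H * th) =
      K * F4 * (f5 * a5) * (a10m * (M10 * f10)) * (a11m * (M11 * f11)) *
        (th2 * g * (Nq * X9 * (X2 * X9b)) * D / (f10 * h * (f11 * f4) * (Qk * f5)) * qk) := by
  have r1 : M1 * M3 * a4m / (r * M8) = qk * K * M10 * M11 * F4 / f4 := by
    rw [div_eq_div_iff (mul_ne_zero hr hM8) hf4]
    refine mul_left_cancel₀ hM4 ?_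
    linear_combination -M1 * M3 * h4 + F4 * hM
  have r2 : H * th / (a7 * a8) = g * th2 / h := by
    rw [div_eq_div_iff (mul_ne_zero ha7 ha8) hh]
    linear_combination h7
  calc _ = (Nq * X2 * D * a5 * X9 * X9b * a10m * a11m / Qk) * (M1 * M3 * a4m / (r * M8)) *
        (H * th / (a7 * a8)) * (Qm / Qm) * (A6 / A6) := by ring
    _ = (Nq * X2 * D * a5 * X9 * X9b * a10m * a11m / Qk) * (qk * K * M10 * M11 * F4 / f4) *
        (g * th2 / h) * (f5 / f5) * (f10 / f10) * (f11 / f11) := by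
      rw [r1, r2, div_self hQm, div_self hA6, div_self hf5, div_self hf10, div_self hf11]
      ring
    _ = _ := by ring

/-- Up to a factor independent of `k`, the summands of the expansion are those of the quadratic
summation. Each factorial of length `m = n - k` is rewritten as one of length `n` divided by one of
length `k`. -/
theorem expansionTerm_eq_quadraticTerm {a c e q s P : ℂ} (hP : ‖P‖ < 1) (ha : a ≠ 0) (hs : s ≠ 0)
    (hc : c = s ^ 2) (he : e ≠ 0) (hq : q ≠ 0) (n k m : ℕ) (hn : k + m = n)
    (h1 : thetaFactorial (e * c / (a * q ^ n)) q P n ≠ 0)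
    (h2 : thetaFactorial (a * e) q P (2 * n + 1) ≠ 0)
    (h3 : thetaFactorial q q P n ≠ 0)
    (h4 : thetaFactorial (a * q ^ (1 + n)) q P n ≠ 0)
    (h5 : thetaFactorial (a * q ^ (1 - (n : ℤ)) / c) q P n ≠ 0)
    (h6 : thetaFactorial (e * (a * q ^ (1 - (n : ℤ)) / c)) q P n ≠ 0)
    (h7 : thetaFactorial (e * (c ^ 2 / a)) q P n ≠ 0) :
    expansionTerm (s ^ 3 / a) (e * s) (s / (a * q ^ n)) (1 / (s * q ^ n)) q P k m *
        (thetaFactorial (e * c / (a * q ^ n)) q P n * thetaFactorial (a * e * q) q P n *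
          modTheta (a * e) P) =
      (c * q ^ n) ^ n * thetaFactorial (e * (a * q ^ (1 - (n : ℤ)) / c)) q P n *
        thetaFactorial (e * (c ^ 2 / a)) q P n * thetaFactorial (1 / (a * q ^ (2 * n))) q P n *
        thetaFactorial (c / a) q P n * quadraticTerm a c e q P n k := by
  have hc0 : c ≠ 0 := by rw [hc]; positivity
  have hkn : k ≤ n := by lia
  have z1 : q ^ (-(n : ℤ)) = (q ^ n)⁻¹ := by rw [zpow_neg, zpow_natCast]
  have z2 : q ^ (1 - (n : ℤ)) = q / q ^ n := by
    rw [zpow_sub₀ hq, zpow_one, zpow_natCast]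
  rw [z2] at h5 h6 ⊢
  have w1 : thetaFactorial (a * e * q ^ k) q P k ≠ 0 := by
    rw [show 2 * n + 1 = k + (k + (2 * m + 1)) by lia, thetaFactorial_add, thetaFactorial_add] at h2
    exact left_ne_zero_of_mul (right_ne_zero_of_mul h2)
  have w2 : thetaFactorial (a * e * q ^ (2 * k + 1)) q P m ≠ 0 := by
    rw [show 2 * n + 1 = 2 * k + 1 + (m + m) by lia, thetaFactorial_add,
      thetaFactorial_add _ q P m m] at h2
    exact left_ne_zero_of_mul (right_ne_zero_of_mul h2)
  have w3 : thetaFactorial (e * (a * q ^ (1 + n))) q P k ≠ 0 := by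
    rw [show 2 * n + 1 = (1 + n) + (k + m) by lia, thetaFactorial_add,
      thetaFactorial_add _ q P k m] at h2
    rw [show e * (a * q ^ (1 + n)) = a * e * q ^ (1 + n) by ring]
    exact left_ne_zero_of_mul (right_ne_zero_of_mul h2)
  have E1 := thetaFactorial_add_reflect (y := q) (z := q ^ (-(n : ℤ))) hP hq k m (by
    rw [z1, hn]; field_simp)
  have E3 := thetaFactorial_reflect (y := c ^ 2 / (a ^ 2 * q ^ k)) (z := a ^ 2 * q / c ^ 2) hP hq k
    (by field_simp)
  have E4 := thetaFactorial_add_reflect (y := c / (a * e)) (z := e * (a * (q / q ^ n) / c)) hP hq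
    k m (by rw [hn]; field_simp)
  have E4' := thetaFactorial_reflect (y := c / (a * e)) (z := e * (a * (q / q ^ n) / c)) hP hq
    (k + m) (by rw [hn]; field_simp)
  have E8 := thetaFactorial_reflect (y := 1 / (a * e * q ^ (k + m + k)))
    (z := a * e * q ^ (2 * k + 1)) hP hq m (by simp only [pow_add, pow_mul]; field_simp; ring)
  have E10 := thetaFactorial_add_reflect (y := 1 / (a * q ^ (2 * (k + m)))) (z := a * q ^ (1 + n))
    hP hq k m (by rw [hn, pow_add, two_mul, pow_add]; field_simp)
  have E11 := thetaFactorial_add_reflect (y := c / a) (z := a * (q / q ^ n) / c) hP hq k m (by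
    rw [hn]; field_simp)
  have E5 := thetaFactorial_add (e * (c ^ 2 / a)) q P k m
  have E7 := modTheta_mul_thetaFactorial_split (a * e) q P k m
  rw [show a * e * q ^ (1 + (k + m)) = e * (a * q ^ (1 + (k + m))) by ring] at E7
  have mono := reflect_monomial_identity ha hc0 he hq k m
  rw [E4] at E4'
  have D1 : s ^ 3 / a / (s / (a * q ^ n)) = c * q ^ n := by rw [hc]; field_simp
  have D2 : s ^ 3 / a * (s / (a * q ^ n)) * q ^ m = c ^ 2 / (a ^ 2 * q ^ k) := by
    rw [hc, ← hn, pow_add]; field_simp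
  have D3 : s ^ 3 / a / (e * s) = c / (a * e) := by rw [hc]; field_simp
  have D4 : s ^ 3 / a * (e * s) * q ^ k = e * (c ^ 2 / a) * q ^ k := by rw [hc]; field_simp
  have D5 : e * s * (s / (a * q ^ n)) = e * c / (a * q ^ n) := by rw [hc]; field_simp
  have D6 : e * s / (s / (a * q ^ n) * q ^ m) = a * e * q ^ k := by
    rw [← hn, pow_add]; field_simp
  have D7 : s / (a * q ^ n) / (e * s * q ^ k) = 1 / (a * e * q ^ (k + m + k)) := by
    rw [← hn, pow_add q (k + m) k]; field_simp
  have D8 : e * s * (1 / (s * q ^ n)) = e * q ^ (-(n : ℤ)) := by rw [z1]; field_simp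
  have D9 : e * s / (1 / (s * q ^ n)) = e * (c * q ^ n) := by rw [hc]; field_simp
  have D10 : s / (a * q ^ n) * (1 / (s * q ^ n)) = 1 / (a * q ^ (2 * (k + m))) := by
    rw [← hn, pow_mul']; field_simp
  have D11 : s / (a * q ^ n) / (1 / (s * q ^ n)) = c / a := by rw [hc]; field_simp
  unfold expansionTerm quadraticTerm
  rw [z2, D1, D2, D3, D4, D5, D6, D7, D8, D9, D10, D11]
  subst hn
  rw [E1, E3, E8, E10, E11, E5]
  have hmon : ∀ y : ℂ, y ≠ 0 → ∀ i j : ℕ, (-y) ^ i * q ^ j ≠ 0 := fun y hy i j =>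
    mul_ne_zero (pow_ne_zero i (neg_ne_zero.mpr hy)) (pow_ne_zero j hq)
  have hle : k ≤ k + m := Nat.le_add_right k m
  exact quadratic_algebra (thetaFactorial_ne_zero_of_le (Nat.le_add_left m k) h3)
    (hmon _ (by positivity) _ _) (hmon _ (div_ne_zero one_ne_zero (by positivity)) _ _) w1 w2 h1 w3
    (thetaFactorial_ne_zero_of_le hle h6) (thetaFactorial_ne_zero_of_le hle h7)
    (thetaFactorial_ne_zero_of_le hle h4) (thetaFactorial_ne_zero_of_le hle h5) (by positivity)
    E4'.symm E7 mono

/-- The Frenkel-Turaev sum in the shape needed below, for generic `e`. -/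
theorem sum_quadraticTerm_of_generic {a c e q P : ℂ} (hP : ‖P‖ < 1) (ha : a ≠ 0) (hc : c ≠ 0)
    (he : e ≠ 0) (hq : q ≠ 0) (n : ℕ)
    (h1 : ∀ i : ℕ, modTheta (e * (c / (a * q ^ n) * q ^ i)) P ≠ 0)
    (h2 : ∀ i j : ℕ, modTheta (e * (a * q ^ n / q ^ i * q ^ j)) P ≠ 0)
    (h3 : thetaFactorial q q P n ≠ 0)
    (h4 : thetaFactorial (a * q ^ (1 + n)) q P n ≠ 0)
    (h5 : thetaFactorial (a * q ^ (1 - (n : ℤ)) / c) q P n ≠ 0)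
    (h6 : thetaFactorial (e * (a * q ^ (1 - (n : ℤ)) / c)) q P n ≠ 0)
    (h7 : thetaFactorial (e * (c ^ 2 / a)) q P n ≠ 0) :
    thetaFactorial (c / (a * q ^ n)) q P n * thetaFactorial (c ^ 2 * q ^ n / a) q P n *
        (thetaFactorial (e * c / (a * q ^ n)) q P n * thetaFactorial (a * e * q) q P n *
          modTheta (a * e) P) =
      (c * q ^ n) ^ n * thetaFactorial (e * (a * q ^ (1 - (n : ℤ)) / c)) q P n *
        thetaFactorial (e * (c ^ 2 / a)) q P n * thetaFactorial (1 / (a * q ^ (2 * n))) q P n *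
        thetaFactorial (c / a) q P n *
        ∑ k ∈ Finset.range (n + 1), quadraticTerm a c e q P n k := by
  obtain ⟨s, hs⟩ := IsAlgClosed.exists_pow_nat_eq c two_pos
  have hs0 : s ≠ 0 := by
    rintro rfl
    exact hc (by simpa using hs.symm)
  have hbc : e * s * (s / (a * q ^ n)) = e * (c / (a * q ^ n)) := by rw [← hs]; ring
  -- these parameters give `b x = e q ^ (-n)`, `b / x = e c q ^ n`, `a / c = c q ^ n`, and the base
  -- `b q ^ (-n) / c = a e` of the resulting well-poised series; the letters on the left of each
  -- equation are those of `sum_expansionTerm`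
  have key := sum_expansionTerm (a := s ^ 3 / a) (b := e * s) (c := s / (a * q ^ n))
    (x := 1 / (s * q ^ n)) hP (by positivity) (by positivity) (by positivity)
    (div_ne_zero one_ne_zero (by positivity)) hq n h3
    (fun i => by rw [hbc, mul_assoc]; exact h1 i)
    (fun i j => by
      rw [show e * s / (s / (a * q ^ n) * q ^ i) * q ^ j = e * (a * q ^ n / q ^ i * q ^ j) by
        field_simp]
      exact h2 i j)
  have g1 : thetaFactorial (e * c / (a * q ^ n)) q P n ≠ 0 :=
    Finset.prod_ne_zero_iff.mpr fun i _ => by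
      rw [show e * c / (a * q ^ n) * q ^ i = e * (c / (a * q ^ n) * q ^ i) by ring]
      exact h1 i
  have g2 : thetaFactorial (a * e) q P (2 * n + 1) ≠ 0 :=
    Finset.prod_ne_zero_iff.mpr fun i _ => by
      rw [show a * e * q ^ i = e * (a * q ^ n / q ^ n * q ^ i) by field_simp]
      exact h2 n i
  rw [show s ^ 3 / a * (1 / (s * q ^ n)) = c / (a * q ^ n) by rw [← hs]; field_simp,
    show s ^ 3 / a / (1 / (s * q ^ n)) = c ^ 2 * q ^ n / a by rw [← hs]; field_simp] at key
  rw [← key, Finset.sum_mul, Finset.mul_sum, ← Finset.Nat.sum_antidiagonal_eq_sum_range_succ_mk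
    (fun t : ℕ × ℕ => (c * q ^ n) ^ n * thetaFactorial (e * (a * q ^ (1 - (n : ℤ)) / c)) q P n *
        thetaFactorial (e * (c ^ 2 / a)) q P n * thetaFactorial (1 / (a * q ^ (2 * n))) q P n *
        thetaFactorial (c / a) q P n * quadraticTerm a c e q P n t.1)]
  refine Finset.sum_congr rfl fun t ht => ?_
  exact expansionTerm_eq_quadraticTerm hP ha hs0 hs.symm he hq n t.1 t.2
    (Finset.HasAntidiagonal.mem_antidiagonal.mp ht) g1 g2 h3 h4 h5 h6 h7

theorem continuousAt_thetaFactorial {f : ℂ → ℂ} {e q P : ℂ} (hP : ‖P‖ < 1) (hq : q ≠ 0) (k : ℕ)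
    (hf : ContinuousAt f e) (h : f e ≠ 0 ∨ P = 0) :
    ContinuousAt (fun t => thetaFactorial (f t) q P k) e := by
  unfold thetaFactorial
  refine tendsto_finsetProd _ fun j _ => ?_
  exact ContinuousAt.comp (f := fun t => f t * q ^ j) (g := fun y => modTheta y P)
    (continuousAt_modTheta hP (h.imp_left fun h => mul_ne_zero h (pow_ne_zero j hq)))
    (hf.mul continuousAt_const)

/-- The quadratic summation, at every `e` where no denominator vanishes. The genericity of `e` is
removed by continuity: the excluded values are countably many, so that their complement is dense.
For `P = 0` the value `e = 0` is allowed. -/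
theorem sum_quadraticTerm {a c e q P : ℂ} (hP : ‖P‖ < 1) (ha : a ≠ 0) (hc : c ≠ 0)
    (he : e ≠ 0 ∨ P = 0) (hq : q ≠ 0) (n : ℕ)
    (h3 : thetaFactorial q q P n ≠ 0)
    (h4 : thetaFactorial (a * q ^ (1 + n)) q P n ≠ 0)
    (h5 : thetaFactorial (a * q ^ (1 - (n : ℤ)) / c) q P n ≠ 0)
    (h6 : thetaFactorial (e * (a * q ^ (1 - (n : ℤ)) / c)) q P n ≠ 0)
    (h7 : thetaFactorial (e * (c ^ 2 / a)) q P n ≠ 0)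
    (h8 : thetaFactorial (e * (a * q ^ (1 + n))) q P n ≠ 0) :
    thetaFactorial (c / (a * q ^ n)) q P n * thetaFactorial (c ^ 2 * q ^ n / a) q P n *
        (thetaFactorial (e * c / (a * q ^ n)) q P n * thetaFactorial (a * e * q) q P n *
          modTheta (a * e) P) =
      (c * q ^ n) ^ n * thetaFactorial (e * (a * q ^ (1 - (n : ℤ)) / c)) q P n *
        thetaFactorial (e * (c ^ 2 / a)) q P n * thetaFactorial (1 / (a * q ^ (2 * n))) q P n *
        thetaFactorial (c / a) q P n *
        ∑ k ∈ Finset.range (n + 1), quadraticTerm a c e q P n k := by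
  -- the values of the parameter at which the expansion does not apply
  let S : Set ℂ := ({0} ∪ ⋃ i : ℕ, {t | t ≠ 0 ∧ modTheta (t * (c / (a * q ^ n) * q ^ i)) P = 0}) ∪
    ⋃ ij : ℕ × ℕ, {t | t ≠ 0 ∧ modTheta (t * (a * q ^ n / q ^ ij.1 * q ^ ij.2)) P = 0}
  have hS : S.Countable :=
    ((Set.countable_singleton 0).union (Set.countable_iUnion fun i =>
      countable_modTheta_mul_eq_zero hP (by positivity))).union
      (Set.countable_iUnion fun ij => countable_modTheta_mul_eq_zero hP (by positivity))
  have hdense : Dense Sᶜ := hS.dense_compl ℝ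
  have hne : (nhdsWithin e Sᶜ).NeBot := mem_closure_iff_nhdsWithin_neBot.mp (hdense e)
  have hz : q ^ (1 - (n : ℤ)) ≠ 0 := zpow_ne_zero _ hq
  have hz' : q ^ (-(n : ℤ)) ≠ 0 := zpow_ne_zero _ hq
  have cont : ∀ (y : ℂ), y ≠ 0 → ∀ k : ℕ,
      ContinuousAt (fun t => thetaFactorial (t * y) q P k) e := fun y hy k =>
    continuousAt_thetaFactorial hP hq k (continuousAt_id.mul continuousAt_const)
      (he.imp_left fun h => mul_ne_zero h hy)
  have cont' : ∀ (f : ℂ → ℂ) (y : ℂ), y ≠ 0 → (∀ t, f t = t * y) → ∀ k : ℕ,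
      ContinuousAt (fun t => thetaFactorial (f t) q P k) e := fun f y hy hf k => by
    simpa only [hf] using cont y hy k
  have contθ : ∀ (f : ℂ → ℂ) (y : ℂ), y ≠ 0 → (∀ t, f t = t * y) →
      ContinuousAt (fun t => modTheta (f t) P) e := fun f y hy hf => by
    simpa [thetaFactorial] using cont' f y hy hf 1
  have c1 := cont (a * q ^ (1 - (n : ℤ)) / c) (by positivity)
  have c2 := cont (c ^ 2 / a) (by positivity)
  have c3 := cont (a * q ^ (1 + n)) (by positivity)
  refine tendsto_nhds_unique_of_eventuallyEq (l := nhdsWithin e Sᶜ)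
    (f := fun t => thetaFactorial (c / (a * q ^ n)) q P n * thetaFactorial (c ^ 2 * q ^ n / a) q P n *
        (thetaFactorial (t * c / (a * q ^ n)) q P n * thetaFactorial (a * t * q) q P n *
          modTheta (a * t) P))
    (g := fun t => (c * q ^ n) ^ n * thetaFactorial (t * (a * q ^ (1 - (n : ℤ)) / c)) q P n *
        thetaFactorial (t * (c ^ 2 / a)) q P n * thetaFactorial (1 / (a * q ^ (2 * n))) q P n *
        thetaFactorial (c / a) q P n *
        ∑ k ∈ Finset.range (n + 1), quadraticTerm a c t q P n k) ?_ ?_ ?_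
  · refine ContinuousAt.continuousWithinAt (ContinuousAt.mul continuousAt_const
      (ContinuousAt.mul (ContinuousAt.mul ?_ ?_) ?_))
    · exact cont' _ (c / (a * q ^ n)) (by positivity) (fun t => by ring) n
    · exact cont' _ (a * q) (by positivity) (fun t => by ring) n
    · exact contθ _ a ha (fun t => by ring)
  · refine ContinuousAt.continuousWithinAt (ContinuousAt.mul (ContinuousAt.mul (ContinuousAt.mul
      (ContinuousAt.mul (ContinuousAt.mul continuousAt_const (c1 n)) (c2 n)) continuousAt_const)
      continuousAt_const) (tendsto_finsetSum _ fun k hk => ?_))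
    have hk : k ≤ n := Nat.lt_succ_iff.mp (Finset.mem_range.mp hk)
    unfold quadraticTerm
    refine ContinuousAt.mul (ContinuousAt.div (ContinuousAt.mul (ContinuousAt.mul (ContinuousAt.mul
      ?_ ?_) (ContinuousAt.mul (ContinuousAt.mul continuousAt_const ?_)
      (ContinuousAt.mul continuousAt_const ?_))) continuousAt_const)
      (ContinuousAt.mul (ContinuousAt.mul (ContinuousAt.mul continuousAt_const (c3 k))
      (ContinuousAt.mul continuousAt_const (c1 k))) (ContinuousAt.mul continuousAt_const (c2 k)))
      ?_) continuousAt_const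
    · exact contθ _ (a * q ^ (2 * k)) (by positivity) (fun t => by ring)
    · exact cont' _ a ha (fun t => by ring) k
    · exact cont _ hz' k
    · exact cont _ (by positivity) k
    · exact mul_ne_zero (mul_ne_zero (mul_ne_zero (thetaFactorial_ne_zero_of_le hk h4)
        (thetaFactorial_ne_zero_of_le hk h8)) (mul_ne_zero (thetaFactorial_ne_zero_of_le hk h5)
        (thetaFactorial_ne_zero_of_le hk h6))) (mul_ne_zero (thetaFactorial_ne_zero_of_le hk h3)
        (thetaFactorial_ne_zero_of_le hk h7))
  · filter_upwards [self_mem_nhdsWithin, nhdsWithin_le_nhds ((c1 n).eventually_ne h6),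
      nhdsWithin_le_nhds ((c2 n).eventually_ne h7)] with t ht h6 h7
    have ht0 : t ≠ 0 := fun h => ht (Or.inl (Or.inl h))
    refine sum_quadraticTerm_of_generic hP ha hc ht0 hq n (fun i h => ht ?_) (fun i j h => ht ?_)
      h3 h4 h5 h6 h7
    · exact Or.inl (Or.inr (Set.mem_iUnion.mpr ⟨i, ht0, h⟩))
    · exact Or.inr (Set.mem_iUnion.mpr ⟨(i, j), ht0, h⟩)

/-! ### From nome `p ^ 2` to nome `p` -/

theorem norm_sq_lt_one {p : ℂ} (hp : ‖p‖ < 1) : ‖p ^ 2‖ < 1 := by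
  rw [norm_pow]; exact pow_lt_one₀ (norm_nonneg p) hp two_ne_zero

theorem thetaFactorial_eq_sq {p : ℂ} (hp : ‖p‖ < 1) (x q : ℂ) (k : ℕ) :
    thetaFactorial x q p k =
      thetaFactorial x q (p ^ 2) k * thetaFactorial (p * x) q (p ^ 2) k := by
  unfold thetaFactorial
  rw [← Finset.prod_mul_distrib]
  refine Finset.prod_congr rfl fun j _ => ?_
  rw [modTheta_eq_sq hp, mul_assoc]

/-- Reversal at a half-period needs no monomial factor; for `p = 0` both sides are `1`. -/
theorem thetaFactorial_half_period_reflect {p q : ℂ} (hq : q ≠ 0) {y z : ℂ} (k : ℕ)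
    (h : y * z * q ^ k = q) :
    thetaFactorial (p * y) q (p ^ 2) k = thetaFactorial (p * z) q (p ^ 2) k := by
  rcases eq_or_ne p 0 with rfl | hp0
  · simp
  induction k generalizing z with
  | zero => simp [thetaFactorial_zero]
  | succ k ih =>
    have h' : z * (y * q ^ k) = 1 := by
      refine mul_right_cancel₀ hq ?_
      rw [pow_succ] at h
      linear_combination h
    have hz : z ≠ 0 := left_ne_zero_of_mul_eq_one h'
    have hinv : p * y * q ^ k = p ^ 2 / (p * z) := by
      field_simp
      linear_combination h'
    rw [thetaFactorial_succ, thetaFactorial_succ_left (p * z),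
      ih (z := z * q) (by rw [pow_succ] at h; linear_combination h), hinv,
      modTheta_nome_div (pow_ne_zero 2 hp0)]
    ring_nf

/-- The prefactor of the left-hand side, which is the value of the quadratic summation. -/
noncomputable def quadraticValue (a c q p : ℂ) (n : ℕ) : ℂ :=
  (thetaFactorial (a * q) q p n * thetaFactorial (a * q / c) q p n *
      thetaFactorial (c ^ 2 / a) q (p ^ 2) (2 * n)) /
    (thetaFactorial (c / a) q p n * thetaFactorial (c ^ 2 / a) q p n *
      thetaFactorial (a * q) q (p ^ 2) (2 * n))

/-- The quadratic summation for nome `p`: the case `e = p`, `P = p ^ 2`. -/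
theorem sum_quadraticTerm_eq_quadraticValue {a c q p : ℂ} (hp : ‖p‖ < 1) (ha : a ≠ 0) (hc : c ≠ 0)
    (hq : q ≠ 0) (n : ℕ)
    (h1 : thetaFactorial (c / a) q p n ≠ 0)
    (h2 : thetaFactorial (c ^ 2 / a) q p n ≠ 0)
    (h3 : thetaFactorial (a * q) q (p ^ 2) (2 * n) ≠ 0)
    (h7 : thetaFactorial (a * q ^ (1 + n)) q p n ≠ 0)
    (h8 : thetaFactorial (a * q ^ (1 - (n : ℤ)) / c) q p n ≠ 0)
    (h9 : thetaFactorial q q (p ^ 2) n ≠ 0) :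
    ∑ k ∈ Finset.range (n + 1), quadraticTerm a c p q (p ^ 2) n k =
      modTheta (a * p) (p ^ 2) * quadraticValue a c q p n := by
  have hP := norm_sq_lt_one hp
  have he : p ≠ 0 ∨ p ^ 2 = 0 := by
    rcases eq_or_ne p 0 with rfl | h
    · right; simp
    · exact Or.inl h
  rw [thetaFactorial_eq_sq hp] at h1 h2 h7 h8
  have h3' := thetaFactorial_add (a * q) q (p ^ 2) n n
  rw [← two_mul, show a * q * q ^ n = a * q ^ (1 + n) by ring] at h3'
  have key := sum_quadraticTerm hP ha hc he hq n h9 (left_ne_zero_of_mul h7)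
    (left_ne_zero_of_mul h8) (right_ne_zero_of_mul h8) (right_ne_zero_of_mul h2)
    (right_ne_zero_of_mul h7)
  have e1 := thetaFactorial_reflect (y := c / (a * q ^ n)) (z := a * q / c) hP hq n (by field_simp)
  have e2 := thetaFactorial_reflect (y := 1 / (a * q ^ (2 * n))) (z := a * q ^ (1 + n)) hP hq n
    (by rw [two_mul, pow_add, pow_add]; field_simp)
  have e3 := thetaFactorial_half_period_reflect (p := p) (y := a * q / c) (z := c / (a * q ^ n)) hq n
    (by field_simp)
  have z2 : q ^ (1 - (n : ℤ)) = q / q ^ n := by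
    rw [zpow_sub₀ hq, zpow_one, zpow_natCast]
  have e4 := thetaFactorial_half_period_reflect (p := p) (y := a * q ^ (1 - (n : ℤ)) / c) (z := c / a)
    hq n (by rw [z2]; field_simp)
  have e5 := thetaFactorial_add (c ^ 2 / a) q (p ^ 2) n n
  rw [← two_mul, show c ^ 2 / a * q ^ n = c ^ 2 * q ^ n / a by ring] at e5
  have e6 : (-(c / (a * q ^ n))) ^ n = (c * q ^ n) ^ n * (-(1 / (a * q ^ (2 * n)))) ^ n := by
    rw [← mul_pow, two_mul, pow_add]
    congr 1
    field_simp
  have hmon : (c * q ^ n) ^ n * ((-(1 / (a * q ^ (2 * n)))) ^ n * q ^ n.choose 2) ≠ 0 := by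
    refine mul_ne_zero (by positivity) (mul_ne_zero (pow_ne_zero _ (neg_ne_zero.mpr ?_))
      (by positivity))
    exact div_ne_zero one_ne_zero (by positivity)
  rw [h3'] at h3
  rw [e1, e2, e4, e6, show p * c / (a * q ^ n) = p * (c / (a * q ^ n)) by ring, ← e3,
    show a * p * q = p * (a * q) by ring] at key
  unfold quadraticValue
  rw [h3', e5, thetaFactorial_eq_sq hp (a * q), thetaFactorial_eq_sq hp (a * q / c),
    thetaFactorial_eq_sq hp (c / a), thetaFactorial_eq_sq hp (c ^ 2 / a)]
  rw [← mul_div_assoc, eq_div_iff (mul_ne_zero (mul_ne_zero h1 h2) h3)]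
  refine mul_left_cancel₀ hmon ?_
  linear_combination -(thetaFactorial (c ^ 2 / a) q (p ^ 2) n * thetaFactorial (a * q) q (p ^ 2) n) *
    key

/-! ### The coefficient of `A_j` -/

/-- The factor that separates the `(j + m)`-th summand of the outer sum, restricted to the
coefficient of `A_j`, from the `m`-th summand of a quadratic summation. -/
noncomputable def coeffFactor (a c q p : ℂ) (n j : ℕ) : ℂ :=
  (thetaFactorial (q ^ (-(n : ℤ))) q p j * thetaFactorial (c * q ^ n) q p j *
      thetaFactorial (a * p) q (p ^ 2) (2 * j) * ((a ^ 2 / c ^ 2) ^ j * q ^ j)) /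
    (modTheta (a * p) (p ^ 2) *
      (thetaFactorial (a * q ^ (1 + n)) q p j * thetaFactorial (a * q ^ (1 - (n : ℤ)) / c) q p j) *
      thetaFactorial (c ^ 2 * p / a) q (p ^ 2) (2 * j))

/-- The algebra behind `summand_eq_coeffFactor_mul_quadraticTerm`. The suffixes `j` and `m` mark the
first `j` and the last `m` factors of a shifted factorial of length `j + m`. -/
theorem coeffFactor_algebra {th th2 Nj Nm Cj Cm apk ap' AP2j APm Dm Dj Uj Um Vj Vm Qm Qj gk g' G2j Gm
    qj qm M1 M2 ρ : ℂ} (hQj : Qj ≠ 0) (hDj : Dj ≠ 0) (hM : M1 = ρ * M2) (hM2 : M2 ≠ 0)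
    (hap : apk * ap' = AP2j * APm) (hg : gk * g' = G2j * Gm) :
    th2 * (Nj * Nm * (Cj * Cm)) * (apk * (Dm * Dj)) /
          (th * (Uj * Um * (Vj * Vm)) * (Qm * Qj * gk)) * (qj * qm) *
        ((ap' * (M1 * Qj)) / (M2 * Dj * g')) =
      Nj * Cj * AP2j * (ρ * qj) / (th * (Uj * Vj) * G2j) *
        (th2 * APm * (Nm * Cm) * Dm / (Um * Vm * (Qm * Gm)) * qm) := by
  calc _ = th2 * Nj * Nm * Cj * Cm * (apk * ap') * Dm / (th * Uj * Um * Vj * Vm * Qm * (gk * g')) *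
        qj * qm * (M1 / M2) * (Qj / Qj) * (Dj / Dj) := by ring
    _ = _ := by
      rw [hap, hg, hM, mul_div_cancel_right₀ _ hM2, div_self hQj, div_self hDj]
      ring

/-- In the coefficient of `A_j`, the summand with outer index `j + m` is, up to `coeffFactor`, the
`m`-th summand of the quadratic summation with `a`, `c`, `n` replaced by `a q ^ (2j)`,
`c q ^ (2j)`, `n - j`. -/
theorem summand_eq_coeffFactor_mul_quadraticTerm {a c q p : ℂ} (hp : ‖p‖ < 1) (ha : a ≠ 0)
    (hc : c ≠ 0) (hq : q ≠ 0) (n j m N : ℕ) (hn : j + N = n) (hm : m ≤ N)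
    (h9 : thetaFactorial q q (p ^ 2) n ≠ 0)
    (h11 : thetaFactorial (c ^ 2 * q ^ (-((j + m : ℕ) : ℤ)) / a ^ 2) q (p ^ 2) (j + m) ≠ 0) :
    (modTheta (a * p * q ^ (2 * (j + m))) (p ^ 2) *
            (thetaFactorial (q ^ (-(n : ℤ))) q p (j + m) *
              thetaFactorial (c * q ^ n) q p (j + m)) *
            (thetaFactorial (a * p) q (p ^ 2) (j + m) *
              thetaFactorial (a ^ 2 * q / c ^ 2) q (p ^ 2) (j + m))) /
          (modTheta (a * p) (p ^ 2) *
            (thetaFactorial (a * q ^ (1 + n)) q p (j + m) *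
              thetaFactorial (a * q ^ (1 - (n : ℤ)) / c) q p (j + m)) *
            (thetaFactorial q q (p ^ 2) (j + m) *
              thetaFactorial (c ^ 2 * p / a) q (p ^ 2) (j + m))) *
        q ^ (j + m) *
        ((thetaFactorial (a * p * q ^ (j + m)) q (p ^ 2) j *
              thetaFactorial (q ^ (-((j + m : ℕ) : ℤ))) q (p ^ 2) j) /
            (thetaFactorial (c ^ 2 * q ^ (-((j + m : ℕ) : ℤ)) / a ^ 2) q (p ^ 2) j *
              thetaFactorial (c ^ 2 * p * q ^ (j + m) / a) q (p ^ 2) j)) =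
      coeffFactor a c q p n j *
        quadraticTerm (a * q ^ (2 * j)) (c * q ^ (2 * j)) p q (p ^ 2) N m := by
  have hP := norm_sq_lt_one hp
  have z1 : q ^ (-((j + m : ℕ) : ℤ)) = 1 / (q ^ j * q ^ m) := by
    rw [zpow_neg, zpow_natCast, pow_add, one_div]
  have z2 : q ^ (-(n : ℤ)) * q ^ j = q ^ (-(N : ℤ)) := by
    rw [← zpow_natCast q j, ← zpow_add₀ hq, ← hn]; congr 1; push_cast; ring
  have z3 : q ^ (1 - (n : ℤ)) * q ^ j = q ^ (1 - (N : ℤ)) := by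
    rw [← zpow_natCast q j, ← zpow_add₀ hq, ← hn]; congr 1; push_cast; ring
  have z4 : q ^ n = q ^ j * q ^ N := by rw [← hn, pow_add]
  -- the first `j` factors are split off the factorials of nome `p`
  have s1 := thetaFactorial_add (q ^ (-(n : ℤ))) q p j m
  have s2 := thetaFactorial_add (c * q ^ n) q p j m
  have s3 := thetaFactorial_add (a * q ^ (1 + n)) q p j m
  have s4 := thetaFactorial_add (a * q ^ (1 - (n : ℤ)) / c) q p j m
  rw [z2, thetaFactorial_eq_sq hp (q ^ (-(N : ℤ)))] at s1
  rw [show c * q ^ n * q ^ j = c * q ^ (2 * j) * q ^ N by rw [z4]; ring,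
    thetaFactorial_eq_sq hp (c * q ^ (2 * j) * q ^ N)] at s2
  rw [show a * q ^ (1 + n) * q ^ j = a * q ^ (2 * j) * q ^ (1 + N) by rw [pow_add, z4]; ring,
    thetaFactorial_eq_sq hp (a * q ^ (2 * j) * q ^ (1 + N))] at s3
  rw [show a * q ^ (1 - (n : ℤ)) / c * q ^ j =
      a * q ^ (2 * j) * q ^ (1 - (N : ℤ)) / (c * q ^ (2 * j)) by rw [← z3]; field_simp,
    thetaFactorial_eq_sq hp (a * q ^ (2 * j) * q ^ (1 - (N : ℤ)) / (c * q ^ (2 * j)))] at s4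
  -- the factorials of nome `p ^ 2` combine with those of the inner sum
  have s5 : thetaFactorial (a * p) q (p ^ 2) (j + m) *
      thetaFactorial (a * p * q ^ (j + m)) q (p ^ 2) j =
      thetaFactorial (a * p) q (p ^ 2) (2 * j) *
        thetaFactorial (a * q ^ (2 * j) * p) q (p ^ 2) m := by
    rw [← thetaFactorial_add, show j + m + j = 2 * j + m by ring, thetaFactorial_add,
      mul_right_comm a p]
  have s6 : thetaFactorial (c ^ 2 * p / a) q (p ^ 2) (j + m) *
      thetaFactorial (c ^ 2 * p * q ^ (j + m) / a) q (p ^ 2) j =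
      thetaFactorial (c ^ 2 * p / a) q (p ^ 2) (2 * j) *
        thetaFactorial (p * ((c * q ^ (2 * j)) ^ 2 / (a * q ^ (2 * j)))) q (p ^ 2) m := by
    rw [show c ^ 2 * p * q ^ (j + m) / a = c ^ 2 * p / a * q ^ (j + m) by ring,
      ← thetaFactorial_add, show j + m + j = 2 * j + m by ring, thetaFactorial_add,
      show p * ((c * q ^ (2 * j)) ^ 2 / (a * q ^ (2 * j))) = c ^ 2 * p / a * q ^ (2 * j) by
        field_simp]
  have s7 : thetaFactorial (a ^ 2 * q / c ^ 2) q (p ^ 2) (j + m) =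
      thetaFactorial ((a * q ^ (2 * j)) ^ 2 * q / (c * q ^ (2 * j)) ^ 2) q (p ^ 2) m *
        thetaFactorial (a ^ 2 * q / c ^ 2 * q ^ m) q (p ^ 2) j := by
    rw [add_comm, thetaFactorial_add,
      show (a * q ^ (2 * j)) ^ 2 * q / (c * q ^ (2 * j)) ^ 2 = a ^ 2 * q / c ^ 2 by field_simp]
  have s8 : thetaFactorial q q (p ^ 2) (j + m) =
      thetaFactorial q q (p ^ 2) m * thetaFactorial (q * q ^ m) q (p ^ 2) j := by
    rw [add_comm, thetaFactorial_add]
  have s9 := thetaFactorial_reflect (y := q ^ (-((j + m : ℕ) : ℤ))) (z := q * q ^ m) hP hq j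
    (by rw [z1]; field_simp)
  have s10 := thetaFactorial_reflect (y := c ^ 2 * q ^ (-((j + m : ℕ) : ℤ)) / a ^ 2)
    (z := a ^ 2 * q / c ^ 2 * q ^ m) hP hq j (by rw [z1]; field_simp)
  have n1 : thetaFactorial (q * q ^ m) q (p ^ 2) j ≠ 0 := by
    have := thetaFactorial_ne_zero_of_le (show j + m ≤ n by lia) h9
    rw [s8] at this
    exact right_ne_zero_of_mul this
  have n2 := thetaFactorial_ne_zero_of_le (Nat.le_add_right j m) h11
  rw [s10] at n2
  have hM : (-q ^ (-((j + m : ℕ) : ℤ))) ^ j * q ^ j.choose 2 = (a ^ 2 / c ^ 2) ^ j *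
      ((-(c ^ 2 * q ^ (-((j + m : ℕ) : ℤ)) / a ^ 2)) ^ j * q ^ j.choose 2) := by
    rw [← mul_assoc, ← mul_pow]
    congr 2
    field_simp
  unfold quadraticTerm coeffFactor
  rw [s1, s2, s3, s4, s7, s8, s9, s10, pow_add q j m,
    show a * p * q ^ (2 * (j + m)) = a * q ^ (2 * j) * p * q ^ (2 * m) by ring]
  rw [pow_add q j m] at s5 s6
  rw [mul_comm (a * q ^ (2 * j)) p] at *
  exact coeffFactor_algebra n1 (right_ne_zero_of_mul n2) hM (left_ne_zero_of_mul n2) s5 s6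

/-- The algebra behind `coeffFactor_mul_quadraticValue`. Primes mark the factorials that belong to
the shifted parameters, the suffix `j` marks factorials of length `j`. -/
theorem quadraticValue_algebra {Nj Cj AP ρq th thα Uj Vj G2j a1 a1' x1' t1' y1' d1' s1' x1 t1 y1 d1
    s1 cj dj b1 b2 e1 xj yj Mc Ma : ℂ} (hth : th ≠ 0) (hUj : Uj ≠ 0) (hVj : Vj ≠ 0)
    (hd : d1 * dj ≠ 0) (hy : y1 ≠ 0) (hs : s1 ≠ 0) (hcj : cj ≠ 0)
    (hAP : AP * thα = th * b2) (ha : a1 * Uj = b1 * b2 * a1') (hs1 : s1 = b1 * s1')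
    (hd1 : d1 * dj = e1 * G2j * d1') (ht : t1 = e1 * t1') (hx : x1 = x1' * xj) (hy1 : y1 = y1' * yj)
    (hc : cj = Mc * xj) (hV : Vj = Ma * yj) (hM : Mc * ρq = Ma) :
    Nj * Cj * AP * ρq / (th * (Uj * Vj) * G2j) * (thα * ((a1' * x1' * t1') / (y1' * d1' * s1'))) =
      (a1 * x1 * t1) / (y1 * d1 * s1) * (Cj * Nj / (cj * dj)) := by
  rw [hs1] at hs
  rw [hy1] at hy
  rw [hc] at hcj
  rw [hd1] at hd
  rw [hV] at hVj
  have hb1 := left_ne_zero_of_mul hs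
  have hs1' := right_ne_zero_of_mul hs
  have hy1' := left_ne_zero_of_mul hy
  have hyj := right_ne_zero_of_mul hy
  have hMc := left_ne_zero_of_mul hcj
  have hxj := right_ne_zero_of_mul hcj
  have hMa := left_ne_zero_of_mul hVj
  have r1 : AP * thα / th = b2 := by rw [hAP, mul_div_cancel_left₀ _ hth]
  have r2 : b2 * a1' / Uj = a1 / b1 := by
    rw [div_eq_div_iff hUj hb1]
    linear_combination -ha
  have r3 : ρq / Ma = 1 / Mc := by
    rw [div_eq_div_iff hMa hMc]
    linear_combination hM
  have r4 : 1 / (G2j * d1') = e1 / (d1 * dj) := by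
    rw [div_eq_div_iff (by rw [mul_assoc] at hd; exact right_ne_zero_of_mul hd) (by rwa [hd1])]
    linear_combination hd1
  calc _ = Nj * Cj * x1' * t1' * (1 / (G2j * d1')) * (AP * thα / th) * a1' / Uj * (ρq / Vj) /
        (y1' * s1') := by ring
    _ = Nj * Cj * x1' * t1' * (1 / (G2j * d1')) * (b2 * a1' / Uj) * (ρq / Ma) /
        (y1' * yj * s1') := by rw [r1, hV]; ring
    _ = Nj * Cj * x1' * t1' * (e1 / (d1 * dj)) * (a1 / b1) * (1 / Mc) / (y1' * yj * s1') *
        (xj / xj) := by rw [r2, r3, r4, div_self hxj, mul_one]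
    _ = _ := by rw [hx, ht, hy1, hs1, hc]; ring

/-- The value of the shifted quadratic summation gives the `j`-th coefficient of the left-hand side.
The first component, a denominator of the shifted summation being nonzero, comes from the same
splitting of factorials. -/
theorem coeffFactor_mul_quadraticValue {a c q p : ℂ} (hp : ‖p‖ < 1) (ha : a ≠ 0)
    (hc : c ≠ 0) (hq : q ≠ 0) (n j N : ℕ) (hn : j + N = n)
    (h1 : thetaFactorial (c / a) q p n ≠ 0)
    (h2 : thetaFactorial (c ^ 2 / a) q p n ≠ 0)
    (h3 : thetaFactorial (a * q) q (p ^ 2) (2 * n) ≠ 0)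
    (h4 : thetaFactorial (c * q ^ (-(n : ℤ)) / a) q p j ≠ 0)
    (h5 : thetaFactorial (c ^ 2 * q ^ n / a) q p j ≠ 0)
    (h6 : modTheta (a * p) (p ^ 2) ≠ 0)
    (h7 : thetaFactorial (a * q ^ (1 + n)) q p j ≠ 0)
    (h8 : thetaFactorial (a * q ^ (1 - (n : ℤ)) / c) q p j ≠ 0) :
    thetaFactorial (c ^ 2 * q ^ (2 * j) / a) q p N ≠ 0 ∧
    coeffFactor a c q p n j * (modTheta (a * q ^ (2 * j) * p) (p ^ 2) *
        quadraticValue (a * q ^ (2 * j)) (c * q ^ (2 * j)) q p N) =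
      quadraticValue a c q p n *
        ((thetaFactorial (c * q ^ n) q p j * thetaFactorial (q ^ (-(n : ℤ))) q p j) /
          (thetaFactorial (c * q ^ (-(n : ℤ)) / a) q p j *
            thetaFactorial (c ^ 2 * q ^ n / a) q p j)) := by
  have z1 : q ^ (-(n : ℤ)) = 1 / (q ^ j * q ^ N) := by
    rw [zpow_neg, zpow_natCast, ← hn, pow_add, one_div]
  have z2 : q ^ (1 - (n : ℤ)) = q / (q ^ j * q ^ N) := by
    rw [zpow_sub₀ hq, zpow_one, zpow_natCast, ← hn, pow_add]
  have hAP : thetaFactorial (a * p) q (p ^ 2) (2 * j) * modTheta (a * q ^ (2 * j) * p) (p ^ 2) =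
      modTheta (a * p) (p ^ 2) * thetaFactorial (p * (a * q)) q (p ^ 2) (2 * j) := by
    rw [mul_right_comm a, ← thetaFactorial_succ, thetaFactorial_succ_left,
      show a * p * q = p * (a * q) by ring]
  have ha1 : thetaFactorial (a * q) q p n * thetaFactorial (a * q ^ (1 + n)) q p j =
      thetaFactorial (a * q) q (p ^ 2) (2 * j) * thetaFactorial (p * (a * q)) q (p ^ 2) (2 * j) *
        thetaFactorial (a * q ^ (2 * j) * q) q p N := by
    rw [← thetaFactorial_eq_sq hp, show a * q ^ (1 + n) = a * q * q ^ n by ring,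
      ← thetaFactorial_add, show a * q ^ (2 * j) * q = a * q * q ^ (2 * j) by ring,
      ← thetaFactorial_add, show 2 * j + N = n + j by lia]
  have hs1 : thetaFactorial (a * q) q (p ^ 2) (2 * n) = thetaFactorial (a * q) q (p ^ 2) (2 * j) *
      thetaFactorial (a * q ^ (2 * j) * q) q (p ^ 2) (2 * N) := by
    rw [show a * q ^ (2 * j) * q = a * q * q ^ (2 * j) by ring, ← thetaFactorial_add, ← hn, mul_add]
  have hg : (c * q ^ (2 * j)) ^ 2 / (a * q ^ (2 * j)) = c ^ 2 * q ^ (2 * j) / a := by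
    field_simp
  have hd1 : thetaFactorial (c ^ 2 / a) q p n * thetaFactorial (c ^ 2 * q ^ n / a) q p j =
      thetaFactorial (c ^ 2 / a) q (p ^ 2) (2 * j) *
        thetaFactorial (c ^ 2 * p / a) q (p ^ 2) (2 * j) *
        thetaFactorial (c ^ 2 * q ^ (2 * j) / a) q p N := by
    rw [show c ^ 2 * p / a = p * (c ^ 2 / a) by ring, ← thetaFactorial_eq_sq hp,
      show c ^ 2 * q ^ n / a = c ^ 2 / a * q ^ n by ring, ← thetaFactorial_add,
      show c ^ 2 * q ^ (2 * j) / a = c ^ 2 / a * q ^ (2 * j) by ring, ← thetaFactorial_add,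
      show 2 * j + N = n + j by lia]
  have ht : thetaFactorial (c ^ 2 / a) q (p ^ 2) (2 * n) =
      thetaFactorial (c ^ 2 / a) q (p ^ 2) (2 * j) *
        thetaFactorial (c ^ 2 * q ^ (2 * j) / a) q (p ^ 2) (2 * N) := by
    rw [show c ^ 2 * q ^ (2 * j) / a = c ^ 2 / a * q ^ (2 * j) by ring, ← thetaFactorial_add, ← hn,
      mul_add]
  have hx : thetaFactorial (a * q / c) q p n =
      thetaFactorial (a * q / c) q p N * thetaFactorial (a * q / c * q ^ N) q p j := by
    rw [← thetaFactorial_add, ← hn, add_comm]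
  have hy : thetaFactorial (c / a) q p n =
      thetaFactorial (c / a) q p N * thetaFactorial (c / a * q ^ N) q p j := by
    rw [← thetaFactorial_add, ← hn, add_comm]
  have hc1 := thetaFactorial_reflect (y := c * q ^ (-(n : ℤ)) / a) (z := a * q / c * q ^ N) hp hq j
    (by rw [z1]; field_simp)
  have hV := thetaFactorial_reflect (y := a * q ^ (1 - (n : ℤ)) / c) (z := c / a * q ^ N) hp hq j
    (by rw [z2]; field_simp)
  have hM : (-(c * q ^ (-(n : ℤ)) / a)) ^ j * q ^ j.choose 2 * ((a ^ 2 / c ^ 2) ^ j * q ^ j) =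
      (-(a * q ^ (1 - (n : ℤ)) / c)) ^ j * q ^ j.choose 2 := by
    rw [mul_right_comm, ← mul_pow, ← mul_pow]
    congr 2
    rw [z1, z2]
    field_simp
  have hd := mul_ne_zero h2 h5
  refine ⟨by rw [hd1] at hd; exact right_ne_zero_of_mul hd, ?_⟩
  unfold coeffFactor quadraticValue
  rw [hg, show c * q ^ (2 * j) / (a * q ^ (2 * j)) = c / a by field_simp,
    show a * q ^ (2 * j) * q / (c * q ^ (2 * j)) = a * q / c by field_simp]
  exact quadraticValue_algebra h6 h7 h8 hd h1 h3 h4 hAP ha1 hs1 hd1 ht hx hy hc1 hV hM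

theorem sum_range_sum_range_succ_comm (f : ℕ → ℕ → ℂ) (n : ℕ) :
    ∑ k ∈ Finset.range (n + 1), ∑ j ∈ Finset.range (k + 1), f k j =
      ∑ j ∈ Finset.range (n + 1), ∑ m ∈ Finset.range (n - j + 1), f (j + m) j := by
  rw [Finset.sum_sigma', Finset.sum_sigma']
  refine Finset.sum_bij' (fun t _ => ⟨t.2, t.1 - t.2⟩) (fun t _ => ⟨t.1 + t.2, t.1⟩) ?_ ?_ ?_ ?_ ?_
  · rintro ⟨k, j⟩ h
    simp only [Finset.mem_sigma, Finset.mem_range] at h ⊢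
    lia
  · rintro ⟨j, m⟩ h
    simp only [Finset.mem_sigma, Finset.mem_range] at h ⊢
    lia
  · rintro ⟨k, j⟩ h
    simp only [Finset.mem_sigma, Finset.mem_range] at h ⊢
    rw [Nat.add_sub_cancel' (by lia)]
  · rintro ⟨j, m⟩ h
    simp
  · rintro ⟨k, j⟩ h
    simp only [Finset.mem_sigma, Finset.mem_range] at h ⊢
    rw [Nat.add_sub_cancel' (by lia)]

theorem mainTheorem4 (a c q p : ℂ) (ha : a ≠ 0) (hc : c ≠ 0) (hq : q ≠ 0) (hp : ‖p‖ < 1)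
    (n : ℕ) (A : ℕ → ℂ)
    -- no denominator on the left-hand side vanishes
    (h1 : thetaFactorial (c / a) q p n ≠ 0)
    (h2 : thetaFactorial (c ^ 2 / a) q p n ≠ 0)
    (h3 : thetaFactorial (a * q) q (p ^ 2) (2 * n) ≠ 0)
    (h4 : thetaFactorial (c * q ^ (-(n : ℤ)) / a) q p n ≠ 0)
    (h5 : thetaFactorial (c ^ 2 * q ^ n / a) q p n ≠ 0)
    -- no denominator in the outer sum on the right-hand side vanishes
    (h6 : modTheta (a * p) (p ^ 2) ≠ 0)
    (h7 : thetaFactorial (a * q ^ (1 + n)) q p n ≠ 0)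
    (h8 : thetaFactorial (a * q ^ (1 - (n : ℤ)) / c) q p n ≠ 0)
    (h9 : thetaFactorial q q (p ^ 2) n ≠ 0)
    (h10 : thetaFactorial (c ^ 2 * p / a) q (p ^ 2) n ≠ 0)
    -- no denominator in the inner sums on the right-hand side vanishes
    (h11 : ∀ k ≤ n, thetaFactorial (c ^ 2 * q ^ (-(k : ℤ)) / a ^ 2) q (p ^ 2) k ≠ 0)
    (h12 : ∀ k ≤ n, thetaFactorial (c ^ 2 * p * q ^ k / a) q (p ^ 2) k ≠ 0) :
    (thetaFactorial (a * q) q p n * thetaFactorial (a * q / c) q p n *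
          thetaFactorial (c ^ 2 / a) q (p ^ 2) (2 * n)) /
        (thetaFactorial (c / a) q p n * thetaFactorial (c ^ 2 / a) q p n *
          thetaFactorial (a * q) q (p ^ 2) (2 * n)) *
      ∑ j ∈ Finset.range (n + 1),
        (thetaFactorial (c * q ^ n) q p j * thetaFactorial (q ^ (-(n : ℤ))) q p j) /
          (thetaFactorial (c * q ^ (-(n : ℤ)) / a) q p j *
            thetaFactorial (c ^ 2 * q ^ n / a) q p j) * A j =
    ∑ k ∈ Finset.range (n + 1),
      (modTheta (a * p * q ^ (2 * k)) (p ^ 2) *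
            (thetaFactorial (q ^ (-(n : ℤ))) q p k * thetaFactorial (c * q ^ n) q p k) *
            (thetaFactorial (a * p) q (p ^ 2) k *
              thetaFactorial (a ^ 2 * q / c ^ 2) q (p ^ 2) k)) /
          (modTheta (a * p) (p ^ 2) *
            (thetaFactorial (a * q ^ (1 + n)) q p k *
              thetaFactorial (a * q ^ (1 - (n : ℤ)) / c) q p k) *
            (thetaFactorial q q (p ^ 2) k * thetaFactorial (c ^ 2 * p / a) q (p ^ 2) k)) *
        q ^ k *
        ∑ j ∈ Finset.range (k + 1),
          (thetaFactorial (a * p * q ^ k) q (p ^ 2) j *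
              thetaFactorial (q ^ (-(k : ℤ))) q (p ^ 2) j) /
            (thetaFactorial (c ^ 2 * q ^ (-(k : ℤ)) / a ^ 2) q (p ^ 2) j *
              thetaFactorial (c ^ 2 * p * q ^ k / a) q (p ^ 2) j) * A j := by
  have hleft : ∀ j ∈ Finset.range (n + 1), quadraticValue a c q p n *
      ((thetaFactorial (c * q ^ n) q p j * thetaFactorial (q ^ (-(n : ℤ))) q p j) /
          (thetaFactorial (c * q ^ (-(n : ℤ)) / a) q p j *
            thetaFactorial (c ^ 2 * q ^ n / a) q p j) * A j) =
      ∑ m ∈ Finset.range (n - j + 1), coeffFactor a c q p n j *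
        quadraticTerm (a * q ^ (2 * j)) (c * q ^ (2 * j)) p q (p ^ 2) (n - j) m * A j := by
    intro j hj
    have hj : j ≤ n := Nat.lt_succ_iff.mp (Finset.mem_range.mp hj)
    have hn : j + (n - j) = n := Nat.add_sub_cancel' hj
    generalize n - j = N at hn
    obtain ⟨g2, hval⟩ := coeffFactor_mul_quadraticValue hp ha hc hq n j N hn h1 h2 h3
      (thetaFactorial_ne_zero_of_le hj h4) (thetaFactorial_ne_zero_of_le hj h5) h6
      (thetaFactorial_ne_zero_of_le hj h7) (thetaFactorial_ne_zero_of_le hj h8)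
    have hNn : N ≤ n := by lia
    have z3 : q ^ (1 - (n : ℤ)) * q ^ j = q ^ (1 - (N : ℤ)) := by
      rw [← zpow_natCast q j, ← zpow_add₀ hq, ← hn]; congr 1; push_cast; ring
    have hsum := sum_quadraticTerm_eq_quadraticValue (a := a * q ^ (2 * j)) (c := c * q ^ (2 * j)) hp
      (by positivity) (by positivity) hq N
      (by
        rw [show c * q ^ (2 * j) / (a * q ^ (2 * j)) = c / a by field_simp]
        exact thetaFactorial_ne_zero_of_le hNn h1)
      (by
        rwa [show (c * q ^ (2 * j)) ^ 2 / (a * q ^ (2 * j)) = c ^ 2 * q ^ (2 * j) / a by field_simp])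
      (by
        rw [show 2 * n = 2 * j + 2 * N by lia, thetaFactorial_add] at h3
        rw [mul_right_comm]
        exact right_ne_zero_of_mul h3)
      (by
        rw [← hn, thetaFactorial_add] at h7
        rw [show a * q ^ (2 * j) * q ^ (1 + N) = a * q ^ (1 + (j + N)) * q ^ j by ring]
        exact right_ne_zero_of_mul h7)
      (by
        rw [show thetaFactorial (a * q ^ (1 - (n : ℤ)) / c) q p n =
          thetaFactorial (a * q ^ (1 - (n : ℤ)) / c) q p (j + N) by rw [hn], thetaFactorial_add] at h8
        rw [show a * q ^ (2 * j) * q ^ (1 - (N : ℤ)) / (c * q ^ (2 * j)) =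
          a * q ^ (1 - (n : ℤ)) / c * q ^ j by rw [← z3]; field_simp]
        exact right_ne_zero_of_mul h8)
      (thetaFactorial_ne_zero_of_le hNn h9)
    rw [← Finset.sum_mul, ← Finset.mul_sum, hsum, hval]
    ring
  change quadraticValue a c q p n * _ = _
  rw [Finset.mul_sum, Finset.sum_congr rfl hleft]
  simp only [Finset.mul_sum]
  rw [sum_range_sum_range_succ_comm]
  refine Finset.sum_congr rfl fun j hj => Finset.sum_congr rfl fun m hm => ?_
  have hj : j ≤ n := Nat.lt_succ_iff.mp (Finset.mem_range.mp hj)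
  have hm : m ≤ n - j := Nat.lt_succ_iff.mp (Finset.mem_range.mp hm)
  rw [← summand_eq_coeffFactor_mul_quadraticTerm hp ha hc hq n j m (n - j)
    (Nat.add_sub_cancel' hj) hm h9 (h11 (j + m) (by lia))]
  ring
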